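/- Let $\sigma,d\ge 1$ be integers, $\mu\in\{1,-1\}$, $\mathbb T=\mathbb R/2\pi\mathbb Z$, and consider on $\mathbb T^d$ the nonlinear Schrödinger equation $$ i\partial_t\psi+\tfrac12\Delta\psi=\mu|\psi|^{2\sigma}\psi \tag{1}$$ and the renormalized cubic equation $$ i\partial_t\psi+\tfrac12\Delta\psi=\mu|\psi|^{2}\psi-\frac{2\mu}{(2\pi)^d}\Big(\int_{\mathbb T^d}|\psi(t,x)|^2\,dx\Big)\psi. \tag{2}$$ For $s\in\mathbb R$ and $p\in[1,\infty]$ let $\|f\|_{\mathcal FL^{s,p}(\mathbb T^d)}=\|\langle k\rangle^s\hat f(k)\|_{\ell^p_k(\mathbb Z^d)}$, where $\langle k\rangle=(1+|k|^2)^{1/2}$ and $\hat f(k)=(2\pi)^{-d}\int_{\mathbb T^d}f(x)e^{-ik\cdot x}\,dx$. (i) Assume $d\sigma\ge 2$ in the case of (1), and $d\ge 2$ in the case of (2). Then for every $s<0$ there exist a sequence of initial data $\varphi_n\in C^\infty(\mathbb T^d)$ with $$\|\varphi_n\|_{\mathcal FL^{s,p}(\mathbb T^d)}\to 0\quad\text{for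 all } p\in[1,\infty],$$ and a sequence of times $t_n>0$, $t_n\to0$, such that for every $n$ the equation (1), respectively (2), has a unique smooth solution $\psi_n$ on $[0,t_n]\times\mathbb T^d$ with $\psi_n(0)=\varphi_n$, and $$\|\psi_n(t_n)\|_{\mathcal FL^{r,p}(\mathbb T^d)}\to\infty\quad\text{for all } r\in\mathbb R \text{ and all } p\in[1,\infty].$$ (ii) If $d=\sigma=1$, then for every $s<-2/3$ the same conclusion holds for (1) and for (2). -/

import Mathlib

open scoped ENNReal ContDiff Laplacian
open MeasureTheory

noncomputable section

namespace PeriodicNLS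

/-- Functions on the torus `(ℝ/2πℤ)^d` are represented by functions on `ℝ^d`
that are `2π`-periodic in every coordinate. -/
def IsPeriodic {d : ℕ} (f : EuclideanSpace ℝ (Fin d) → ℂ) : Prop :=
  ∀ (i : Fin d) (x : EuclideanSpace ℝ (Fin d)),
    f (x + EuclideanSpace.single i (2 * Real.pi)) = f x

/-- The period cell `[0, 2π]^d`. -/
def cell (d : ℕ) : Set (EuclideanSpace ℝ (Fin d)) :=
  {x | ∀ i, x i ∈ Set.Icc 0 (2 * Real.pi)}

/-- `f̂(k) = (2π)^{-d} ∫_{𝕋^d} f(x) e^{-i k·x} dx`. -/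
def fourierCoeff {d : ℕ} (f : EuclideanSpace ℝ (Fin d) → ℂ) (k : Fin d → ℤ) : ℂ :=
  ((2 * Real.pi : ℝ) : ℂ)⁻¹ ^ d *
    ∫ x in cell d, f x * Complex.exp (-Complex.I * ((∑ i, (k i : ℝ) * x i : ℝ) : ℂ))

/-- `⟨k⟩ = (1 + |k|²)^{1/2}`. -/
def japaneseBracket {d : ℕ} (k : Fin d → ℤ) : ℝ :=
  Real.sqrt (1 + ∑ i, (k i : ℝ) ^ 2)

/-- The Fourier-Lebesgue norm `‖⟨·⟩^s f̂‖_{ℓ^p(ℤ^d)}`, with values in `[0, ∞]`. -/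
def flNorm {d : ℕ} (s : ℝ) (p : ℝ≥0∞) (f : EuclideanSpace ℝ (Fin d) → ℂ) : ℝ≥0∞ :=
  eLpNorm (fun k : Fin d → ℤ => ((japaneseBracket k ^ s : ℝ) : ℂ) * fourierCoeff f k) p
    Measure.count

/-- The nonlinearity `μ |ψ|^{2σ} ψ`. -/
def powerNonlinearity (d : ℕ) (μ : ℝ) (σ : ℕ) (f : EuclideanSpace ℝ (Fin d) → ℂ) :
    EuclideanSpace ℝ (Fin d) → ℂ :=
  fun x => (μ : ℂ) * ((‖f x‖ ^ (2 * σ) : ℝ) : ℂ) * f x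

/-- The nonlinearity `μ |ψ|² ψ - 2μ (2π)^{-d} (∫_{𝕋^d} |ψ|² dx) ψ`. -/
def renormalizedNonlinearity (d : ℕ) (μ : ℝ) (f : EuclideanSpace ℝ (Fin d) → ℂ) :
    EuclideanSpace ℝ (Fin d) → ℂ :=
  fun x => (μ : ℂ) * ((‖f x‖ ^ 2 : ℝ) : ℂ) * f x
    - ((2 * μ / (2 * Real.pi) ^ d * ∫ y in cell d, ‖f y‖ ^ 2 : ℝ) : ℂ) * f x

/-- `ψ` is a smooth solution on `[0, T] × 𝕋^d` of `i ∂ₜψ + ½ Δψ = F(ψ)`, the time derivatives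
being one-sided at the end points of `[0, T]`. -/
structure IsSmoothSolution {d : ℕ}
    (F : (EuclideanSpace ℝ (Fin d) → ℂ) → EuclideanSpace ℝ (Fin d) → ℂ) (T : ℝ)
    (ψ : ℝ → EuclideanSpace ℝ (Fin d) → ℂ) : Prop where
  periodic : ∀ t ∈ Set.Icc 0 T, IsPeriodic (ψ t)
  smooth : ContDiffOn ℝ ∞ (fun q : ℝ × EuclideanSpace ℝ (Fin d) => ψ q.1 q.2)
    (Set.Icc 0 T ×ˢ Set.univ)
  equation : ∀ t ∈ Set.Icc 0 T, ∀ x,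
    Complex.I * derivWithin (fun τ => ψ τ x) (Set.Icc 0 T) t + (1 / 2 : ℂ) * (Δ (ψ t)) x
      = F (ψ t) x

/-- Norm inflation at regularity `s` with infinite loss of regularity for
`i ∂ₜψ + ½ Δψ = F(ψ)` on `𝕋^d`: there are smooth data `φ n`, times `t n > 0` tending to `0`,
and the (unique) smooth solutions `ψ n` on `[0, t n]` with data `φ n`, such that `φ n → 0` in
`FL^{s,p}` for all `p ∈ [1, ∞]` while the `FL^{r,p}` norm of `ψ n (t n)` tends to `∞` for all
real `r` and all `p ∈ [1, ∞]`. -/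
def HasNormInflation {d : ℕ}
    (F : (EuclideanSpace ℝ (Fin d) → ℂ) → EuclideanSpace ℝ (Fin d) → ℂ) (s : ℝ) : Prop :=
  ∃ (φ : ℕ → EuclideanSpace ℝ (Fin d) → ℂ) (t : ℕ → ℝ)
    (ψ : ℕ → ℝ → EuclideanSpace ℝ (Fin d) → ℂ),
    (∀ n, ContDiff ℝ ∞ (φ n) ∧ IsPeriodic (φ n)) ∧
    (∀ p : ℝ≥0∞, 1 ≤ p → Filter.Tendsto (fun n => flNorm s p (φ n)) Filter.atTop (nhds 0)) ∧
    (∀ n, 0 < t n) ∧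
    Filter.Tendsto t Filter.atTop (nhds 0) ∧
    (∀ n, IsSmoothSolution F (t n) (ψ n) ∧ ψ n 0 = φ n) ∧
    (∀ n χ, IsSmoothSolution F (t n) χ → χ 0 = φ n →
      ∀ τ ∈ Set.Icc 0 (t n), χ τ = ψ n τ) ∧
    (∀ (r : ℝ) (p : ℝ≥0∞), 1 ≤ p →
      Filter.Tendsto (fun n => flNorm r p (ψ n (t n))) Filter.atTop (nhds ∞))

end PeriodicNLS

end

/-
Weight the Fourier coefficients by `e^{ρ|k|₁}`. The weighted `ℓ¹` space is a convolution algebra, so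
that in the interaction picture the equation is an ODE with a locally Lipschitz vector field:
Picard–Lindelöf yields solutions that are analytic in `x`, and an `L²` estimate gives uniqueness.

The data `A ∑ⱼ e^{i N κⱼ·x}` with `κⱼ ≠ 0` has `FL^{s,p}` norm of order `A N^s`, and for `ρ = 1 / N`
its weighted `ℓ¹` norm is at most a constant times `A`, uniformly in `N`. When `θ = T A^{2σ}` is
small, the zero mode of the solution at time `T` is therefore that of the first Picard iterate up to
`O(A θ²)`; the zero mode is seen by every `FL^{r,p}` norm with weight `1`.

A resonant interaction `∑ ± κⱼ = 0`, `∑ ± |κⱼ|² = 0` does not oscillate, so it contributes `A θ` to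
the zero mode however large `N` is, and any `s < 0` is admissible: in two dimensions the vertices of
a rectangle are resonant, and on the line `1 - 3 + 1 - 3 + 4 = 0` is. On the circle the cubic
interaction `1 - 2 + 1 = 0` has phase `N² t`, hence stays coherent only up to `T = N⁻²`, and
`A N^s → 0`, `A² N⁻² → 0`, `A³ N⁻² → ∞` can be achieved simultaneously precisely when `s < -2/3`.
-/

open scoped NNReal

noncomputable section

namespace PeriodicNLS

/-! ### Absolutely summable families -/

/-- The space `ℓ¹(ι)` of absolutely summable complex families. -/
abbrev SummableFamily (ι : Type*) : Type _ := lp (fun _ : ι => ℂ) 1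

namespace SummableFamily

variable {ι Y : Type*} [NormedAddCommGroup Y] [NormedSpace ℂ Y]

theorem hasSum_norm (b : SummableFamily ι) : HasSum (fun k => ‖b k‖) ‖b‖ := by
  simpa using lp.hasSum_norm (p := 1) (by simp) b

theorem norm_apply_le (b : SummableFamily ι) (k : ι) : ‖b k‖ ≤ ‖b‖ :=
  lp.norm_apply_le_norm one_ne_zero b k

/-- The coordinate functional `b ↦ b k` on `ℓ¹(ι)`. -/
def coord (k : ι) : SummableFamily ι →L[ℂ] ℂ := lp.evalCLM ℂ (fun _ => ℂ) 1 k

@[simp] theorem coord_apply (k : ι) (b : SummableFamily ι) : coord k b = b k := rfl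

theorem norm_coord_le (k : ι) : ‖coord k‖ ≤ 1 :=
  ContinuousLinearMap.opNorm_le_bound _ zero_le_one fun b => by
    simpa using norm_apply_le b k

section UnitVectors

variable [DecidableEq ι]

/-- The unit vector of `ℓ¹(ι)` supported at `k`. -/
def delta (k : ι) : SummableFamily ι := lp.single 1 k 1

@[simp] theorem norm_delta (k : ι) : ‖delta k‖ = 1 := by
  simp [delta, lp.norm_single]

theorem delta_apply (k j : ι) : delta k j = if j = k then 1 else 0 := by
  simp [delta, lp.single_apply, Pi.single_apply]

theorem hasSum_smul_delta (b : SummableFamily ι) : HasSum (fun k => b k • delta k) b := by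
  simpa [delta, ← lp.single_smul] using lp.hasSum_single (p := 1) (by simp) b

theorem hom_ext {f g : SummableFamily ι →L[ℂ] Y} (h : ∀ k, f (delta k) = g (delta k)) : f = g :=
  lp.ext_continuousLinearMap (by simp) fun k => ContinuousLinearMap.ext_ring (h k)

theorem bilin_ext {f g : SummableFamily ι →L[ℂ] SummableFamily ι →L[ℂ] Y}
    (h : ∀ j k, f (delta j) (delta k) = g (delta j) (delta k)) : f = g :=
  hom_ext fun j => hom_ext (h j)

theorem apply_star_eq_conj {f g : SummableFamily ι →L[ℂ] ℂ}
    (h : ∀ k, f (delta k) = starRingEnd ℂ (g (delta k))) (b : SummableFamily ι) :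
    f (star b) = starRingEnd ℂ (g b) := by
  have hf := (hasSum_smul_delta (star b)).mapL f
  have hg := ((hasSum_smul_delta b).mapL g).map (starRingEnd ℂ) Complex.continuous_conj
  refine hf.unique ?_
  convert hg using 2 with k
  simp [h]

end UnitVectors

section Lift

variable [CompleteSpace Y] {B : ι → Y}

theorem summable_smul (hB : ∀ k, ‖B k‖ ≤ 1) (b : SummableFamily ι) :
    Summable fun k => b k • B k :=
  .of_norm_bounded (hasSum_norm b).summable fun k => by
    simpa only [norm_smul] using mul_le_of_le_one_right (norm_nonneg _) (hB k)

/-- The linear contraction `ℓ¹(ι) → Y` that sends the unit vector at `k` to `B k`. -/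
def lift (B : ι → Y) (hB : ∀ k, ‖B k‖ ≤ 1) : SummableFamily ι →L[ℂ] Y :=
  LinearMap.mkContinuous
    { toFun := fun b => ∑' k, b k • B k
      map_add' := fun a b => by
        rw [← (summable_smul hB a).tsum_add (summable_smul hB b)]
        simp [add_smul]
      map_smul' := fun c a => by
        rw [RingHom.id_apply, ← (summable_smul hB a).tsum_const_smul c]
        simp [mul_smul] } 1 fun b => by
    rw [one_mul]
    refine tsum_of_norm_bounded (hasSum_norm b) fun k => ?_
    rw [norm_smul]
    exact mul_le_of_le_one_right (norm_nonneg _) (hB k)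

theorem lift_apply (hB : ∀ k, ‖B k‖ ≤ 1) (b : SummableFamily ι) :
    lift B hB b = ∑' k, b k • B k := rfl

theorem norm_lift_le (hB : ∀ k, ‖B k‖ ≤ 1) : ‖lift B hB‖ ≤ 1 :=
  LinearMap.mkContinuous_norm_le _ zero_le_one _

theorem norm_lift_apply_le (hB : ∀ k, ‖B k‖ ≤ 1) (b : SummableFamily ι) :
    ‖lift B hB b‖ ≤ ‖b‖ := by
  simpa using (lift B hB).le_of_opNorm_le (norm_lift_le hB) b

@[simp] theorem lift_delta [DecidableEq ι] (hB : ∀ k, ‖B k‖ ≤ 1) (k : ι) :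
    lift B hB (delta k) = B k := by
  rw [lift_apply, tsum_eq_single k fun j hj => by simp [delta_apply, hj]]
  simp [delta_apply]

theorem lift_eq_tsum (hB : ∀ k, ‖B k‖ ≤ 1) (hs : Summable fun k => ‖B k‖) :
    lift B hB = ∑' k, (coord k).smulRight (B k) := by
  have hsum : Summable fun k => (coord k).smulRight (B k) :=
    .of_norm_bounded hs fun k => by
      rw [ContinuousLinearMap.norm_smulRight_apply]
      exact mul_le_of_le_one_left (norm_nonneg _) (norm_coord_le k)
  ext b
  simpa [lift_apply] using (hsum.hasSum.mapL (ContinuousLinearMap.apply ℂ Y b)).tsum_eq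

end Lift

/-- The diagonal contraction of `ℓ¹(ι)` with symbol `m`. -/
def multiplier [DecidableEq ι] (m : ι → ℂ) (hm : ∀ k, ‖m k‖ ≤ 1) :
    SummableFamily ι →L[ℂ] SummableFamily ι :=
  lift (fun k => m k • delta k) fun k => by simpa [norm_smul] using hm k

@[simp] theorem multiplier_delta [DecidableEq ι] {m : ι → ℂ} (hm : ∀ k, ‖m k‖ ≤ 1) (k : ι) :
    multiplier m hm (delta k) = m k • delta k := lift_delta _ k

@[simp] theorem multiplier_apply [DecidableEq ι] {m : ι → ℂ} (hm : ∀ k, ‖m k‖ ≤ 1)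
    (b : SummableFamily ι) (k : ι) : multiplier m hm b k = m k * b k := by
  have : (coord k).comp (multiplier m hm) = m k • coord k := hom_ext fun j => by
    by_cases h : k = j <;> simp [delta_apply, h]
  exact DFunLike.congr_fun this b

theorem norm_multiplier_apply_le [DecidableEq ι] {m : ι → ℂ} (hm : ∀ k, ‖m k‖ ≤ 1)
    (b : SummableFamily ι) : ‖multiplier m hm b‖ ≤ ‖b‖ := norm_lift_apply_le _ b

end SummableFamily

/-! ### Superpositions of plane waves -/

section PlaneWave

theorem norm_cexp_I_smul {Z : Type*} [SeminormedAddCommGroup Z] [NormedSpace ℂ Z]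
    (θ : ℝ) (z : Z) : ‖Complex.exp (Complex.I * θ) • z‖ = ‖z‖ := by
  rw [norm_smul, mul_comm Complex.I, Complex.norm_exp_ofReal_mul_I, one_mul]

variable {E Z : Type*} [NormedAddCommGroup E] [NormedSpace ℝ E] [NormedAddCommGroup Z]
  [NormedSpace ℂ Z] [NormedSpace ℝ Z] [IsScalarTower ℝ ℂ Z]

theorem iteratedDeriv_cexp_smul (z : Z) (n : ℕ) :
    iteratedDeriv n (fun u : ℝ => Complex.exp (Complex.I * u) • z) =
      fun u : ℝ => (Complex.I ^ n * Complex.exp (Complex.I * u)) • z := by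
  induction n with
  | zero => simp
  | succ n ih =>
    rw [iteratedDeriv_succ, ih]
    funext u
    have h : HasDerivAt (fun u : ℝ => Complex.I * (u : ℂ)) Complex.I u := by
      simpa using (Complex.ofRealCLM.hasDerivAt (x := u)).const_mul Complex.I
    rw [((h.cexp.const_mul (Complex.I ^ n)).smul_const z).deriv]
    ring_nf

theorem contDiff_cexp_smul (ℓ : E →L[ℝ] ℝ) (z : Z) {n : WithTop ℕ∞} :
    ContDiff ℝ n fun x => Complex.exp (Complex.I * ℓ x) • z :=
  (contDiff_const.mul (Complex.ofRealCLM.contDiff.comp ℓ.contDiff)).cexp.smul contDiff_const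

theorem norm_iteratedFDeriv_cexp_smul_le (ℓ : E →L[ℝ] ℝ) (z : Z) (n : ℕ) (x : E) :
    ‖iteratedFDeriv ℝ n (fun x => Complex.exp (Complex.I * ℓ x) • z) x‖ ≤ ‖z‖ * ‖ℓ‖ ^ n := by
  have hg : ContDiff ℝ n fun u : ℝ => Complex.exp (Complex.I * u) • z := by
    simpa using contDiff_cexp_smul (ContinuousLinearMap.id ℝ ℝ) z
  calc ‖iteratedFDeriv ℝ n ((fun u : ℝ => Complex.exp (Complex.I * u) • z) ∘ ℓ) x‖
      ≤ ‖iteratedFDeriv ℝ n (fun u : ℝ => Complex.exp (Complex.I * u) • z) (ℓ x)‖ * ‖ℓ‖ ^ n := by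
        rw [ℓ.iteratedFDeriv_comp_right hg x le_rfl]
        simpa using ContinuousMultilinearMap.norm_compContinuousLinearMap_le
          (iteratedFDeriv ℝ n (fun u : ℝ => Complex.exp (Complex.I * u) • z) (ℓ x)) fun _ => ℓ
    _ = ‖z‖ * ‖ℓ‖ ^ n := by
        rw [norm_iteratedFDeriv_eq_norm_iteratedDeriv, iteratedDeriv_cexp_smul]
        simp only [mul_smul, norm_smul (Complex.I ^ n), norm_cexp_I_smul, norm_pow,
          Complex.norm_I, one_pow, one_mul]

variable {ι : Type*}

theorem contDiff_lift_planeWave [CompleteSpace Z] (ℓ : ι → E →L[ℝ] ℝ) {z : ι → Z}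
    (hz : ∀ k, ‖z k‖ ≤ 1) (hs : ∀ n : ℕ, Summable fun k => ‖z k‖ * ‖ℓ k‖ ^ n) :
    ContDiff ℝ ∞ fun x => SummableFamily.lift (fun k => Complex.exp (Complex.I * ℓ k x) • z k)
      fun k => (norm_cexp_I_smul _ _).trans_le (hz k) := by
  have hsum : ∀ x, SummableFamily.lift (fun k => Complex.exp (Complex.I * ℓ k x) • z k)
      (fun k => (norm_cexp_I_smul _ _).trans_le (hz k)) =
      ∑' k, Complex.exp (Complex.I * ℓ k x) • (SummableFamily.coord k).smulRight (z k) := by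
    intro x
    rw [SummableFamily.lift_eq_tsum _ (by simpa [norm_cexp_I_smul] using hs 0)]
    congr! 2 with k
    ext b
    exact smul_comm (M := ℂ) (b k) (Complex.exp (Complex.I * ℓ k x)) (z k)
  simp only [hsum]
  refine contDiff_tsum (v := fun n k => ‖z k‖ * ‖ℓ k‖ ^ n) (N := ⊤)
    (fun k => contDiff_cexp_smul _ _) (fun n _ => hs n) fun n k x _ =>
      (norm_iteratedFDeriv_cexp_smul_le _ _ _ _).trans ?_
  gcongr
  rw [ContinuousLinearMap.norm_smulRight_apply]
  exact mul_le_of_le_one_left (norm_nonneg _) (SummableFamily.norm_coord_le k)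

end PlaneWave

/-! ### Frequencies -/

section Frequency

variable {d : ℕ}

/-- The norm `|k|₁ = ∑ᵢ |kᵢ|` of a frequency. -/
def absSum (k : Fin d → ℤ) : ℝ := ∑ i, |(k i : ℝ)|

theorem absSum_nonneg (k : Fin d → ℤ) : 0 ≤ absSum k :=
  Finset.sum_nonneg fun _ _ => abs_nonneg _

@[simp] theorem absSum_zero : absSum (0 : Fin d → ℤ) = 0 := by simp [absSum]

theorem absSum_add_le (j k : Fin d → ℤ) : absSum (j + k) ≤ absSum j + absSum k := by
  simp only [absSum, ← Finset.sum_add_distrib, Pi.add_apply, Int.cast_add]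
  exact Finset.sum_le_sum fun i _ => abs_add_le _ _

@[simp] theorem absSum_neg (k : Fin d → ℤ) : absSum (-k) = absSum k := by simp [absSum]

theorem sum_sq_le_absSum_sq (k : Fin d → ℤ) : ∑ i, (k i : ℝ) ^ 2 ≤ absSum k ^ 2 := by
  simpa only [absSum, sq_abs] using Finset.sum_sq_le_sq_sum_of_nonneg (s := Finset.univ)
    fun i _ => abs_nonneg (k i : ℝ)

/-- The frequency `|k|²/2` in time of the free plane wave with wave vector `k`. -/
def dispersion (k : Fin d → ℤ) : ℝ := (∑ i, (k i : ℝ) ^ 2) / 2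

@[simp] theorem dispersion_zero : dispersion (0 : Fin d → ℤ) = 0 := by simp [dispersion]

theorem dispersion_nonneg (k : Fin d → ℤ) : 0 ≤ dispersion k := by
  unfold dispersion
  positivity

theorem dispersion_le (k : Fin d → ℤ) : dispersion k ≤ absSum k ^ 2 :=
  (half_le_self (by positivity)).trans (sum_sq_le_absSum_sq k)

/-- The weight `e^{-ρ|k|₁}`, the inverse of the analytic weight with radius `ρ`. -/
def weight (ρ : ℝ≥0) (k : Fin d → ℤ) : ℝ := Real.exp (-ρ * absSum k)

theorem weight_pos (ρ : ℝ≥0) (k : Fin d → ℤ) : 0 < weight ρ k := Real.exp_pos _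

theorem weight_le_one (ρ : ℝ≥0) (k : Fin d → ℤ) : weight ρ k ≤ 1 := by
  have := mul_nonneg ρ.coe_nonneg (absSum_nonneg k)
  exact Real.exp_le_one_iff.2 (by linarith)

@[simp] theorem weight_zero (ρ : ℝ≥0) : weight ρ (0 : Fin d → ℤ) = 1 := by simp [weight]

@[simp] theorem weight_neg (ρ : ℝ≥0) (k : Fin d → ℤ) : weight ρ (-k) = weight ρ k := by
  simp [weight]

theorem weight_add_left (θ ρ : ℝ≥0) (k : Fin d → ℤ) :
    weight (θ + ρ) k = weight θ k * weight ρ k := by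
  simp [weight, ← Real.exp_add, add_mul, add_comm]

theorem weight_mul_weight_le (ρ : ℝ≥0) (j k : Fin d → ℤ) :
    weight ρ j * weight ρ k ≤ weight ρ (j + k) := by
  rw [weight, weight, weight, ← Real.exp_add, Real.exp_le_exp]
  linarith [mul_le_mul_of_nonneg_left (absSum_add_le j k) ρ.coe_nonneg]

theorem norm_weight (ρ : ℝ≥0) (k : Fin d → ℤ) : ‖(weight ρ k : ℂ)‖ = weight ρ k := by
  rw [Complex.norm_real, Real.norm_of_nonneg (weight_pos ρ k).le]

theorem norm_weight_le_one (ρ : ℝ≥0) (k : Fin d → ℤ) : ‖(weight ρ k : ℂ)‖ ≤ 1 :=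
  (norm_weight ρ k).trans_le (weight_le_one ρ k)

theorem summable_exp_neg_mul_abs_int {θ : ℝ} (hθ : 0 < θ) :
    Summable fun n : ℤ => Real.exp (-θ * |(n : ℝ)|) := by
  have h : Summable fun n : ℕ => Real.exp (n * -θ) :=
    Real.summable_exp_nat_mul_iff.2 (neg_lt_zero.2 hθ)
  refine .of_nat_of_neg ?_ ?_ <;> simpa [mul_comm] using h

theorem summable_prod_apply {n : ℕ} {ι : Type*} {f : ι → ℝ} (hf : Summable f) (h0 : ∀ i, 0 ≤ f i) :
    Summable fun k : Fin n → ι => ∏ i, f (k i) := by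
  classical
  refine summable_of_sum_le (c := (∑' i, f i) ^ n) (fun k => Finset.prod_nonneg fun i _ => h0 _)
    fun u => ?_
  set box := Fintype.piFinset fun i : Fin n => u.image fun k => k i
  have hu : u ⊆ box := fun k hk =>
    Fintype.mem_piFinset.2 fun i => Finset.mem_image_of_mem _ hk
  calc ∑ k ∈ u, ∏ i, f (k i) ≤ ∑ k ∈ box, ∏ i, f (k i) :=
        Finset.sum_le_sum_of_subset_of_nonneg hu fun _ _ _ => Finset.prod_nonneg fun i _ => h0 _
    _ = ∏ i : Fin n, ∑ j ∈ u.image (fun k => k i), f j := (Finset.prod_univ_sum _ _).symm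
    _ ≤ ∏ _i : Fin n, ∑' j, f j :=
        Finset.prod_le_prod (fun _ _ => Finset.sum_nonneg fun _ _ => h0 _)
          fun i _ => hf.sum_le_tsum _ fun _ _ => h0 _
    _ = (∑' j, f j) ^ n := by simp

theorem summable_weight {θ : ℝ≥0} (hθ : 0 < θ) : Summable fun k : Fin d → ℤ => weight θ k := by
  have h := summable_prod_apply (n := d) (summable_exp_neg_mul_abs_int (NNReal.coe_pos.2 hθ))
    fun _ => (Real.exp_pos _).le
  simpa only [weight, absSum, Finset.mul_sum, Real.exp_sum] using h

theorem pow_le_factorial_mul_exp {θ x : ℝ} (hθ : 0 < θ) (hx : 0 ≤ x) (n : ℕ) :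
    x ^ n ≤ n.factorial / θ ^ n * Real.exp (θ * x) := by
  have h := Real.pow_div_factorial_le_exp (x := θ * x) (by positivity) n
  rw [mul_pow, div_le_iff₀ (by positivity)] at h
  rw [div_mul_eq_mul_div, le_div_iff₀ (by positivity)]
  linarith

theorem summable_weight_mul_pow {θ : ℝ≥0} (hθ : 0 < θ) {a : (Fin d → ℤ) → ℝ}
    (ha : ∀ k, 0 ≤ a k) (hle : ∀ k, a k ≤ (1 + absSum k) ^ 2) (n : ℕ) :
    Summable fun k : Fin d → ℤ => weight θ k * a k ^ n := by
  have hθ2 : (0 : ℝ) < θ / 2 := half_pos (NNReal.coe_pos.2 hθ)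
  set M : ℝ := (2 * n).factorial / (θ / 2) ^ (2 * n) * Real.exp (θ / 2)
  refine .of_nonneg_of_le (fun k => mul_nonneg (weight_pos θ k).le (pow_nonneg (ha k) n))
    (fun k => ?_) ((summable_weight (d := d) (half_pos hθ)).mul_left M)
  have h1 : (0 : ℝ) ≤ 1 + absSum k := add_nonneg zero_le_one (absSum_nonneg k)
  calc weight θ k * a k ^ n ≤ weight θ k * (1 + absSum k) ^ (2 * n) := by
        rw [pow_mul]
        exact mul_le_mul_of_nonneg_left (pow_le_pow_left₀ (ha k) (hle k) n) (weight_pos θ k).le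
    _ ≤ weight θ k * ((2 * n).factorial / (θ / 2) ^ (2 * n) *
          Real.exp (θ / 2 * (1 + absSum k))) :=
        mul_le_mul_of_nonneg_left (pow_le_factorial_mul_exp hθ2 h1 _) (weight_pos θ k).le
    _ = M * weight (θ / 2) k := by
        simp only [M, weight, NNReal.coe_div, NNReal.coe_ofNat]
        rw [mul_assoc _ (Real.exp _) (Real.exp _), mul_left_comm, ← Real.exp_add, ← Real.exp_add]
        ring_nf

/-- The linear form `x ↦ k·x`. -/
def freqForm (k : Fin d → ℤ) : EuclideanSpace ℝ (Fin d) →L[ℝ] ℝ :=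
  ∑ i, (k i : ℝ) • EuclideanSpace.proj i

theorem freqForm_apply (k : Fin d → ℤ) (x : EuclideanSpace ℝ (Fin d)) :
    freqForm k x = ∑ i, (k i : ℝ) * x i := by simp [freqForm]

theorem freqForm_add (j k : Fin d → ℤ) : freqForm (j + k) = freqForm j + freqForm k := by
  simp [freqForm, add_smul, Finset.sum_add_distrib]

theorem freqForm_neg (k : Fin d → ℤ) : freqForm (-k) = -freqForm k := by
  simp [freqForm]

theorem freqForm_single (k : Fin d → ℤ) (i : Fin d) (c : ℝ) :
    freqForm k (EuclideanSpace.single i c) = k i * c := by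
  simp [freqForm_apply]

theorem norm_freqForm_le (k : Fin d → ℤ) : ‖freqForm k‖ ≤ absSum k := by
  refine norm_sum_le_of_le _ fun i _ => ?_
  rw [norm_smul, Real.norm_eq_abs]
  exact mul_le_of_le_one_right (abs_nonneg _) <|
    ContinuousLinearMap.opNorm_le_bound _ zero_le_one fun x => by
      simpa using PiLp.norm_apply_le x i

/-- The phase `k·x - t|k|²/2` of a free plane wave, as a linear form in `(t, x)`. -/
def phase (k : Fin d → ℤ) : ℝ × EuclideanSpace ℝ (Fin d) →L[ℝ] ℝ :=
  (freqForm k).comp (ContinuousLinearMap.snd ℝ ℝ _) -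
    dispersion k • ContinuousLinearMap.fst ℝ ℝ _

theorem phase_apply (k : Fin d → ℤ) (q : ℝ × EuclideanSpace ℝ (Fin d)) :
    phase k q = freqForm k q.2 - dispersion k * q.1 := by simp [phase]

theorem norm_phase_le (k : Fin d → ℤ) : ‖phase k‖ ≤ absSum k + absSum k ^ 2 := by
  refine norm_sub_le_of_le ?_ ?_
  · refine (ContinuousLinearMap.opNorm_comp_le _ _).trans ?_
    exact (mul_le_of_le_one_right (norm_nonneg _) (ContinuousLinearMap.norm_snd_le ..)).trans
      (norm_freqForm_le k)
  · rw [norm_smul, Real.norm_of_nonneg (dispersion_nonneg k)]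
    exact (mul_le_of_le_one_right (dispersion_nonneg k)
      (ContinuousLinearMap.norm_fst_le ..)).trans (dispersion_le k)

end Frequency

/-! ### Integration over the period cell -/

section Cell

variable {d : ℕ} {Y : Type*} [NormedAddCommGroup Y]

theorem cell_eq_preimage : cell d =
    (MeasurableEquiv.toLp 2 (Fin d → ℝ)).symm ⁻¹' Set.Icc 0 (fun _ => 2 * Real.pi) := by
  ext x
  exact ⟨fun h => ⟨fun i => (h i).1, fun i => (h i).2⟩, fun h i => ⟨h.1 i, h.2 i⟩⟩

theorem setIntegral_cell [NormedSpace ℝ Y] (f : EuclideanSpace ℝ (Fin d) → Y) :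
    ∫ x in cell d, f x =
      ∫ y in Set.Icc (0 : Fin d → ℝ) (fun _ => 2 * Real.pi), f (WithLp.toLp 2 y) := by
  rw [cell_eq_preimage, ← (EuclideanSpace.volume_preserving_symm_measurableEquiv_toLp
    (Fin d)).setIntegral_preimage_emb (MeasurableEquiv.measurableEmbedding _)]
  rfl

theorem volume_cell : volume (cell d) = ENNReal.ofReal ((2 * Real.pi) ^ d) := by
  rw [cell_eq_preimage, (EuclideanSpace.volume_preserving_symm_measurableEquiv_toLp
    (Fin d)).measure_preimage_equiv, Real.volume_Icc_pi]
  simp [ENNReal.ofReal_pow Real.two_pi_pos.le]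

theorem isCompact_cell : IsCompact (cell d) := by
  have : cell d = WithLp.toLp 2 '' Set.Icc (0 : Fin d → ℝ) (fun _ => 2 * Real.pi) := by
    rw [cell_eq_preimage]
    exact ((MeasurableEquiv.toLp 2 (Fin d → ℝ)).toEquiv.image_eq_preimage_symm _).symm
  rw [this]
  exact isCompact_Icc.image (PiLp.continuous_toLp 2 _)

theorem measurableSet_cell : MeasurableSet (cell d) := isCompact_cell.measurableSet

theorem integrableOn_cell {f : EuclideanSpace ℝ (Fin d) → Y} (hf : Continuous f) :
    IntegrableOn f (cell d) :=
  hf.continuousOn.integrableOn_compact isCompact_cell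

theorem setIntegral_Icc_fderiv_single_eq_zero {n : ℕ} [NormedSpace ℝ Y]
    {a b : Fin (n + 1) → ℝ} (hab : a ≤ b) {g : (Fin (n + 1) → ℝ) → Y} (hg : ContDiff ℝ 1 g)
    {i : Fin (n + 1)} (hface : ∀ y, g (i.insertNth (b i) y) = g (i.insertNth (a i) y)) :
    ∫ x in Set.Icc a b, fderiv ℝ g x (Pi.single i 1) = 0 := by
  have hsum : ∀ x, ∑ j, (if j = i then fderiv ℝ g x else 0) (Pi.single j 1) =
      fderiv ℝ g x (Pi.single i 1) := fun x => by
    rw [Finset.sum_eq_single i (fun j _ hj => by simp [hj]) (by simp), if_pos rfl]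
  have hcont : Continuous fun x => fderiv ℝ g x (Pi.single i 1) :=
    (hg.continuous_fderiv one_ne_zero).clm_apply continuous_const
  have hdiv := integral_divergence_of_hasFDerivAt_off_countable' a b hab
    (fun j x => if j = i then g x else 0) (fun j x => if j = i then fderiv ℝ g x else 0)
    ∅ Set.countable_empty
    (fun j => by
      split_ifs
      exacts [hg.continuous.continuousOn, continuousOn_const])
    (fun x _ j => by
      split_ifs
      exacts [(hg.differentiable one_ne_zero x).hasFDerivAt, hasFDerivAt_const 0 x])
    (by simpa only [hsum] using hcont.continuousOn.integrableOn_compact isCompact_Icc)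
  simp only [hsum] at hdiv
  rw [hdiv]
  refine Finset.sum_eq_zero fun j _ => ?_
  obtain rfl | h := eq_or_ne j i
  · simp only [if_true, hface, sub_self]
  · simp [h]

theorem integral_cell_fderiv_eq_zero {g : EuclideanSpace ℝ (Fin d) → ℂ} (hg : ContDiff ℝ 1 g)
    (hper : IsPeriodic g) (i : Fin d) :
    ∫ x in cell d, fderiv ℝ g x (EuclideanSpace.single i 1) = 0 := by
  obtain ⟨n, rfl⟩ : ∃ n, d = n + 1 := ⟨d - 1, by have := i.2; omega⟩
  set L := (EuclideanSpace.equiv (Fin (n + 1)) ℝ).symm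
  have hface : ∀ y, g (L (i.insertNth (2 * Real.pi) y)) = g (L (i.insertNth 0 y)) := fun y => by
    rw [← hper i (L (i.insertNth 0 y))]
    congr 1
    ext l
    refine Fin.succAboveCases i ?_ (fun m => ?_) l <;> simp [L, Fin.succAbove_ne]
  have h := setIntegral_Icc_fderiv_single_eq_zero (a := 0) (b := fun _ => 2 * Real.pi)
    (fun _ => Real.two_pi_pos.le) (hg.comp L.contDiff) hface
  rw [setIntegral_cell, ← h]
  simp only [L.comp_right_fderiv]
  rfl

theorem isPeriodic_cexp (k : Fin d → ℤ) :
    IsPeriodic fun x => Complex.exp (Complex.I * freqForm k x) := fun i x => by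
  have : Complex.exp (Complex.I * ((k i * (2 * Real.pi) : ℝ) : ℂ)) = 1 :=
    Complex.exp_eq_one_iff.2 ⟨k i, by push_cast; ring⟩
  simp only [map_add, freqForm_single]
  rw [Complex.ofReal_add, mul_add, Complex.exp_add, this, mul_one]

theorem hasFDerivAt_cexp {E : Type*} [NormedAddCommGroup E] [NormedSpace ℝ E] (ℓ : E →L[ℝ] ℝ)
    (x : E) : HasFDerivAt (fun x => Complex.exp (Complex.I * ℓ x))
      ((Complex.exp (Complex.I * ℓ x) * Complex.I) • Complex.ofRealCLM.comp ℓ) x := by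
  simpa [smul_smul] using
    (((Complex.ofRealCLM.comp ℓ).hasFDerivAt (x := x)).const_mul Complex.I).cexp

theorem integral_cell_cexp (k : Fin d → ℤ) :
    ∫ x in cell d, Complex.exp (Complex.I * freqForm k x) =
      if k = 0 then ((2 * Real.pi : ℝ) : ℂ) ^ d else 0 := by
  split_ifs with hk
  · simp [hk, freqForm_apply, measureReal_def, volume_cell, pow_nonneg Real.two_pi_pos.le]
  · obtain ⟨i, hi⟩ := Function.ne_iff.1 hk
    have hsmooth : ContDiff ℝ 1 fun x => Complex.exp (Complex.I * freqForm k x) := by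
      simpa using contDiff_cexp_smul (freqForm k) (1 : ℂ)
    have h := integral_cell_fderiv_eq_zero hsmooth (isPeriodic_cexp k) i
    simp only [(hasFDerivAt_cexp (freqForm k) _).fderiv, _root_.smul_apply,
      ContinuousLinearMap.comp_apply, freqForm_single, smul_eq_mul, mul_assoc,
      integral_mul_const] at h
    simpa [show k i ≠ 0 from hi] using h

theorem fourierCoeff_cexp (j k : Fin d → ℤ) :
    fourierCoeff (fun x => Complex.exp (Complex.I * freqForm j x)) k = if k = j then 1 else 0 := by
  have hmul : ∀ x : EuclideanSpace ℝ (Fin d), Complex.exp (Complex.I * freqForm j x) *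
      Complex.exp (-Complex.I * ((∑ i, (k i : ℝ) * x i : ℝ) : ℂ)) =
      Complex.exp (Complex.I * freqForm (j + -k) x) := fun x => by
    rw [← Complex.exp_add, freqForm_add, freqForm_neg, ← freqForm_apply]
    simp [mul_add]
  have hpi : ((2 * Real.pi : ℝ) : ℂ) ≠ 0 := by exact_mod_cast Real.two_pi_pos.ne'
  simp only [fourierCoeff, hmul, integral_cell_cexp, add_neg_eq_zero, eq_comm (a := k)]
  split_ifs
  · rw [← mul_pow, inv_mul_cancel₀ hpi, one_pow]
  · rw [mul_zero]

end Cell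

/-! ### Weighted Fourier coefficients -/

open SummableFamily

theorem contDiffOn_clm_apply {E V W : Type*} [NormedAddCommGroup E] [NormedSpace ℝ E]
    [NormedAddCommGroup V] [NormedSpace ℂ V] [NormedSpace ℝ V] [IsScalarTower ℝ ℂ V]
    [NormedAddCommGroup W] [NormedSpace ℂ W] [NormedSpace ℝ W] [IsScalarTower ℝ ℂ W]
    {n : WithTop ℕ∞} {s : Set E} {f : E → V →L[ℂ] W} {g : E → V} (hf : ContDiffOn ℝ n f s)
    (hg : ContDiffOn ℝ n g s) : ContDiffOn ℝ n (fun x => f x (g x)) s :=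
  ((ContinuousLinearMap.restrictScalarsL ℂ V W ℝ ℝ).contDiff.comp_contDiffOn hf).clm_apply hg

theorem contDiff_clm_apply {E V W : Type*} [NormedAddCommGroup E] [NormedSpace ℝ E]
    [NormedAddCommGroup V] [NormedSpace ℂ V] [NormedSpace ℝ V] [IsScalarTower ℝ ℂ V]
    [NormedAddCommGroup W] [NormedSpace ℂ W] [NormedSpace ℝ W] [IsScalarTower ℝ ℂ W]
    {n : WithTop ℕ∞} {f : E → V →L[ℂ] W} {g : E → V} (hf : ContDiff ℝ n f)
    (hg : ContDiff ℝ n g) : ContDiff ℝ n (fun x => f x (g x)) :=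
  contDiffOn_univ.1 (contDiffOn_clm_apply hf.contDiffOn hg.contDiffOn)

section Coeffs

variable {d : ℕ}

/-- The Banach space of weighted Fourier coefficients: for a radius `ρ`, the element `b` stands
for the function on the torus whose Fourier coefficients are `e^{-ρ|k|₁} b_k`. -/
abbrev Coeffs (d : ℕ) : Type := SummableFamily (Fin d → ℤ)

/-- Multiplication of the coefficients by `e^{-θ|k|₁}`, which changes the radius by `θ`. -/
def damp (θ : ℝ≥0) : Coeffs d →L[ℂ] Coeffs d :=
  multiplier (fun k => (weight θ k : ℂ)) (norm_weight_le_one θ)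

@[simp] theorem damp_apply (θ : ℝ≥0) (b : Coeffs d) (k : Fin d → ℤ) :
    damp θ b k = weight θ k * b k := multiplier_apply _ b k

@[simp] theorem damp_delta (θ : ℝ≥0) (k : Fin d → ℤ) :
    damp θ (delta k) = (weight θ k : ℂ) • delta k := multiplier_delta _ k

/-- The free Schrödinger group, `b_k ↦ e^{-it|k|²/2} b_k`. -/
def freeGroup (t : ℝ) : Coeffs d →L[ℂ] Coeffs d :=
  multiplier (fun k => Complex.exp (Complex.I * (-dispersion k * t : ℝ))) fun _ =>
    (Complex.norm_exp_I_mul_ofReal _).le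

@[simp] theorem freeGroup_apply (t : ℝ) (b : Coeffs d) (k : Fin d → ℤ) :
    freeGroup t b k = Complex.exp (Complex.I * (-dispersion k * t : ℝ)) * b k :=
  multiplier_apply _ b k

@[simp] theorem freeGroup_delta (t : ℝ) (k : Fin d → ℤ) :
    freeGroup t (delta k) = Complex.exp (Complex.I * (-dispersion k * t : ℝ)) • delta k :=
  multiplier_delta _ k

theorem norm_freeGroup_apply_le (t : ℝ) (b : Coeffs d) : ‖freeGroup t b‖ ≤ ‖b‖ :=
  norm_multiplier_apply_le _ b

theorem freeGroup_freeGroup_neg (t : ℝ) (b : Coeffs d) : freeGroup t (freeGroup (-t) b) = b := by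
  ext k; simp [← mul_assoc, ← Complex.exp_add]

theorem damp_freeGroup (θ : ℝ≥0) (t : ℝ) (b : Coeffs d) :
    damp θ (freeGroup t b) = freeGroup t (damp θ b) := by
  ext k; simp [mul_left_comm]

theorem damp_damp (θ θ' : ℝ≥0) (b : Coeffs d) : damp θ (damp θ' b) = damp (θ + θ') b := by
  ext k; simp [weight_add_left, mul_assoc]

theorem continuous_freeGroup_apply (b : Coeffs d) : Continuous fun t => freeGroup t b := by
  simp only [freeGroup, multiplier, lift_apply]
  refine continuous_tsum (fun k => by fun_prop) (hasSum_norm b).summable fun k t => ?_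
  rw [norm_smul, norm_cexp_I_smul, norm_delta, mul_one]

theorem continuous_freeGroup_uncurry :
    Continuous fun q : ℝ × Coeffs d => freeGroup q.1 q.2 :=
  continuous_prod_of_continuous_lipschitzWith' _ 1
    (fun t => LipschitzWith.of_dist_le_mul fun a b => by
      simpa [dist_eq_norm, ← map_sub] using norm_freeGroup_apply_le t (a - b))
    continuous_freeGroup_apply

theorem contDiff_damp_comp_freeGroup {θ : ℝ≥0} (hθ : 0 < θ) :
    ContDiff ℝ ∞ fun t : ℝ => (damp θ).comp (freeGroup (d := d) t) := by
  have h := contDiff_lift_planeWave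
    (fun k : Fin d → ℤ => -dispersion k • ContinuousLinearMap.id ℝ ℝ)
    (z := fun k => (weight θ k : ℂ) • (delta k : Coeffs d))
    (fun k => by rw [norm_smul, norm_delta, mul_one]; exact norm_weight_le_one θ k) fun n => ?_
  · convert h using 1
    funext t
    exact hom_ext fun k => by simp
  · simp only [norm_smul, norm_weight, norm_delta, mul_one]
    refine summable_weight_mul_pow hθ (fun k => by positivity) (fun k => ?_) n
    rw [Real.norm_eq_abs, abs_neg, abs_of_nonneg (dispersion_nonneg k),
      ContinuousLinearMap.norm_id, mul_one]
    nlinarith [dispersion_le k, absSum_nonneg k]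

/-- The product of functions in terms of their coefficients weighted with radius `ρ`. -/
def conv (ρ : ℝ≥0) : Coeffs d →L[ℂ] Coeffs d →L[ℂ] Coeffs d :=
  lift (fun j => lift
    (fun k => (weight ρ j * weight ρ k / weight ρ (j + k) : ℝ) • delta (j + k)) fun k => by
      rw [norm_smul, norm_delta, mul_one, Real.norm_of_nonneg (div_nonneg
        (mul_pos (weight_pos ρ j) (weight_pos ρ k)).le (weight_pos ρ _).le)]
      exact div_le_one_of_le₀ (weight_mul_weight_le ρ j k) (weight_pos ρ _).le)
    fun j => norm_lift_le _

@[simp] theorem conv_delta_delta (ρ : ℝ≥0) (j k : Fin d → ℤ) :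
    conv ρ (delta j) (delta k) =
      (weight ρ j * weight ρ k / weight ρ (j + k) : ℂ) • delta (j + k) := by
  rw [conv, lift_delta, lift_delta]
  norm_cast

theorem norm_conv_le (ρ : ℝ≥0) (b c : Coeffs d) : ‖conv ρ b c‖ ≤ ‖b‖ * ‖c‖ :=
  (conv ρ b).le_of_opNorm_le (norm_lift_apply_le _ b) c

theorem damp_conv (θ ρ : ℝ≥0) (b c : Coeffs d) :
    damp θ (conv (θ + ρ) b c) = conv ρ (damp θ b) (damp θ c) := by
  have : ((damp θ).postcomp (Coeffs d)).comp (conv (θ + ρ)) =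
      (conv ρ).bilinearComp (damp θ) (damp (d := d) θ) := bilin_ext fun j k => by
    have hθ : (weight θ (j + k) : ℂ) ≠ 0 := by exact_mod_cast (weight_pos θ (j + k)).ne'
    have hρ : (weight ρ (j + k) : ℂ) ≠ 0 := by exact_mod_cast (weight_pos ρ (j + k)).ne'
    simp only [ContinuousLinearMap.comp_apply, ContinuousLinearMap.postcomp_apply,
      conv_delta_delta, map_smul, damp_delta, ContinuousLinearMap.bilinearComp_apply, smul_smul,
      _root_.smul_apply, weight_add_left]
    congr 1
    push_cast
    field_simp
  exact DFunLike.congr_fun (DFunLike.congr_fun this b) c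

theorem contDiff_conv {n : WithTop ℕ∞} (ρ : ℝ≥0) {f g : Coeffs d → Coeffs d}
    (hf : ContDiff ℝ n f) (hg : ContDiff ℝ n g) : ContDiff ℝ n fun b => conv ρ (f b) (g b) :=
  contDiff_clm_apply (((conv ρ).restrictScalars ℝ).contDiff.comp hf) hg

/-- The coefficients `k ↦ conj b_{-k}` of the complex conjugate function. -/
def conjRefl : Coeffs d →L[ℝ] Coeffs d :=
  ((lift (fun k => delta (-k)) fun _ => (norm_delta _).le).restrictScalars ℝ).comp
    (starL' ℝ : Coeffs d ≃L[ℝ] Coeffs d).toContinuousLinearMap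

@[simp] theorem conjRefl_apply (b : Coeffs d) (k : Fin d → ℤ) :
    conjRefl b k = starRingEnd ℂ (b (-k)) :=
  apply_star_eq_conj (f := (coord k).comp (lift (fun k => delta (-k))
    fun _ => (norm_delta _).le)) (g := coord (-k)) (fun j => by
      by_cases h : k = -j <;> simp [delta_apply, h, neg_eq_iff_eq_neg]) b

theorem norm_conjRefl_le (b : Coeffs d) : ‖conjRefl b‖ ≤ ‖b‖ :=
  (norm_lift_apply_le (fun k => (norm_delta (-k)).le) (star b)).trans_eq (norm_star b)

theorem damp_conjRefl (θ : ℝ≥0) (b : Coeffs d) :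
    damp θ (conjRefl b) = conjRefl (damp θ b) := by
  ext k; simp

/-- The value at `(t, x)` of the free wave with coefficients `e^{-ρ|k|₁} b_k` at time `0`. -/
def wave (ρ : ℝ≥0) (q : ℝ × EuclideanSpace ℝ (Fin d)) : Coeffs d →L[ℂ] ℂ :=
  lift (fun k => Complex.exp (Complex.I * phase k q) • (weight ρ k : ℂ)) fun k =>
    (norm_cexp_I_smul _ _).trans_le (norm_weight_le_one ρ k)

theorem wave_delta (ρ : ℝ≥0) (q : ℝ × EuclideanSpace ℝ (Fin d)) (k : Fin d → ℤ) :
    wave ρ q (delta k) = Complex.exp (Complex.I * phase k q) * weight ρ k :=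
  lift_delta _ k

theorem contDiff_wave {ρ : ℝ≥0} (hρ : 0 < ρ) : ContDiff ℝ ∞ (wave (d := d) ρ) := by
  refine contDiff_lift_planeWave phase (norm_weight_le_one ρ) fun n => ?_
  simp only [norm_weight]
  refine summable_weight_mul_pow hρ (fun k => norm_nonneg _) (fun k => ?_) n
  nlinarith [norm_phase_le k, absSum_nonneg k]

theorem wave_damp (θ ρ : ℝ≥0) (q : ℝ × EuclideanSpace ℝ (Fin d)) (b : Coeffs d) :
    wave ρ q (damp θ b) = wave (θ + ρ) q b := by
  have : (wave ρ q).comp (damp θ) = wave (θ + ρ) q := hom_ext fun k => by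
    simp [wave_delta, weight_add_left, mul_left_comm]
  exact DFunLike.congr_fun this b

/-- The value at `x` of the function with Fourier coefficients `e^{-ρ|k|₁} b_k`. -/
def synth (ρ : ℝ≥0) (x : EuclideanSpace ℝ (Fin d)) : Coeffs d →L[ℂ] ℂ := wave ρ (0, x)

theorem synth_delta (ρ : ℝ≥0) (x : EuclideanSpace ℝ (Fin d)) (k : Fin d → ℤ) :
    synth ρ x (delta k) = Complex.exp (Complex.I * freqForm k x) * weight ρ k := by
  rw [synth, wave_delta, phase_apply, mul_zero, sub_zero]

theorem synth_freeGroup (ρ : ℝ≥0) (t : ℝ) (x : EuclideanSpace ℝ (Fin d)) (b : Coeffs d) :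
    synth ρ x (freeGroup t b) = wave ρ (t, x) b := by
  have : (synth ρ x).comp (freeGroup t) = wave ρ (t, x) := hom_ext fun k => by
    simp only [ContinuousLinearMap.comp_apply, freeGroup_delta, map_smul, synth_delta, wave_delta,
      smul_eq_mul, phase_apply, ← mul_assoc, ← Complex.exp_add]
    congr 2
    push_cast
    ring
  exact DFunLike.congr_fun this b

theorem synth_conv (ρ : ℝ≥0) (x : EuclideanSpace ℝ (Fin d)) (b c : Coeffs d) :
    synth ρ x (conv ρ b c) = synth ρ x b * synth ρ x c := by
  have : ((synth ρ x).postcomp (Coeffs d)).comp (conv ρ) =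
      (ContinuousLinearMap.mul ℂ ℂ).bilinearComp (synth ρ x) (synth ρ x) := bilin_ext fun j k => by
    have hw : (weight ρ (j + k) : ℂ) ≠ 0 := by exact_mod_cast (weight_pos ρ (j + k)).ne'
    have he : Complex.exp (Complex.I * freqForm (j + k) x) =
        Complex.exp (Complex.I * freqForm j x) * Complex.exp (Complex.I * freqForm k x) := by
      rw [← Complex.exp_add, freqForm_add]
      simp [mul_add]
    simp only [ContinuousLinearMap.comp_apply, ContinuousLinearMap.postcomp_apply,
      conv_delta_delta, map_smul, synth_delta, ContinuousLinearMap.bilinearComp_apply, smul_eq_mul,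
      ContinuousLinearMap.mul_apply', he]
    field_simp
  exact DFunLike.congr_fun (DFunLike.congr_fun this b) c

theorem synth_conjRefl (ρ : ℝ≥0) (x : EuclideanSpace ℝ (Fin d)) (b : Coeffs d) :
    synth ρ x (conjRefl b) = starRingEnd ℂ (synth ρ x b) :=
  apply_star_eq_conj (f := (synth ρ x).comp (lift (fun k => delta (-k))
    fun _ => (norm_delta _).le)) (g := synth ρ x) (fun j => by
      simp [synth_delta, freqForm_neg, ← Complex.exp_conj]) b

theorem contDiff_synth {ρ : ℝ≥0} (hρ : 0 < ρ) : ContDiff ℝ ∞ (synth (d := d) ρ) :=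
  (contDiff_wave hρ).comp (contDiff_const.prodMk contDiff_id)

theorem contDiff_synth_apply {ρ : ℝ≥0} (hρ : 0 < ρ) (b : Coeffs d) :
    ContDiff ℝ ∞ fun x => synth ρ x b :=
  contDiff_clm_apply (contDiff_synth hρ) contDiff_const

theorem isPeriodic_synth (ρ : ℝ≥0) (b : Coeffs d) : IsPeriodic fun x => synth ρ x b := by
  intro i x
  have : synth ρ (x + EuclideanSpace.single i (2 * Real.pi)) = synth ρ x := hom_ext fun k => by
    rw [synth_delta, synth_delta]
    exact congrArg (· * _) (isPeriodic_cexp k i x)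
  exact DFunLike.congr_fun this b

theorem fourierCoeff_synth {ρ : ℝ≥0} (hρ : 0 < ρ) (b : Coeffs d) (k : Fin d → ℤ) :
    fourierCoeff (fun x => synth ρ x b) k = weight ρ k * b k := by
  set e : EuclideanSpace ℝ (Fin d) → ℂ :=
    fun x => Complex.exp (-Complex.I * ((∑ i, (k i : ℝ) * x i : ℝ) : ℂ))
  set L : Coeffs d →L[ℂ] ℂ :=
    ((2 * Real.pi : ℝ) : ℂ)⁻¹ ^ d • ∫ x in cell d, e x • synth (d := d) ρ x
  have hint : IntegrableOn (fun x => e x • synth (d := d) ρ x) (cell d) :=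
    integrableOn_cell ((by fun_prop : Continuous e).smul (contDiff_synth hρ).continuous)
  have hL : ∀ c, fourierCoeff (fun x => synth ρ x c) k = L c := fun c => by
    rw [_root_.smul_apply, ContinuousLinearMap.integral_apply hint]
    simp [fourierCoeff, e, mul_comm]
  have : L = (weight ρ k : ℂ) • coord k := hom_ext fun j => by
    have h := fourierCoeff_cexp j k
    simp only [fourierCoeff] at h
    simp only [← hL, synth_delta, fourierCoeff, mul_right_comm _ (weight ρ j : ℂ),
      integral_mul_const, ← mul_assoc, h]
    by_cases hjk : k = j <;> simp [delta_apply, hjk]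
  rw [hL, this]
  simp

end Coeffs

/-! ### Nonlinearities on Fourier coefficients -/

section Nonlinearity

variable {d : ℕ}

/-- The coefficients of `|u|^{2m} u`, where `u` has coefficients `b`. -/
def powConv (ρ : ℝ≥0) : ℕ → Coeffs d → Coeffs d
  | 0, b => b
  | m + 1, b => conv ρ b (conv ρ (conjRefl b) (powConv ρ m b))

theorem contDiff_powConv (ρ : ℝ≥0) {n : WithTop ℕ∞} (m : ℕ) :
    ContDiff ℝ n (powConv (d := d) ρ m) := by
  induction m with
  | zero => exact contDiff_id
  | succ m ih => exact contDiff_conv ρ contDiff_id (contDiff_conv ρ conjRefl.contDiff ih)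

theorem powConv_zero (ρ : ℝ≥0) (m : ℕ) : powConv ρ m (0 : Coeffs d) = 0 := by
  cases m <;> simp [powConv]

theorem damp_powConv (θ ρ : ℝ≥0) (m : ℕ) (b : Coeffs d) :
    damp θ (powConv (θ + ρ) m b) = powConv ρ m (damp θ b) := by
  induction m with
  | zero => rfl
  | succ m ih => simp only [powConv, damp_conv, damp_conjRefl, ih]

theorem synth_powConv (ρ : ℝ≥0) (m : ℕ) (b : Coeffs d) (x : EuclideanSpace ℝ (Fin d)) :
    synth ρ x (powConv ρ m b) = ((‖synth ρ x b‖ ^ (2 * m) : ℝ) : ℂ) * synth ρ x b := by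
  induction m with
  | zero => simp [powConv]
  | succ m ih =>
    rw [powConv, synth_conv, synth_conv, synth_conjRefl, ih, ← mul_assoc, Complex.mul_conj',
      ← mul_assoc]
    push_cast
    ring

theorem norm_conv_conv_le (ρ : ℝ≥0) (a b c : Coeffs d) :
    ‖conv ρ a (conv ρ b c)‖ ≤ ‖a‖ * (‖b‖ * ‖c‖) :=
  (norm_conv_le ρ a _).trans (mul_le_mul_of_nonneg_left (norm_conv_le ρ b c) (norm_nonneg a))

theorem norm_powConv_le (ρ : ℝ≥0) (m : ℕ) {b : Coeffs d} {R : ℝ} (hb : ‖b‖ ≤ R) :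
    ‖powConv ρ m b‖ ≤ R ^ (2 * m + 1) := by
  have hR : 0 ≤ R := (norm_nonneg b).trans hb
  induction m with
  | zero => simpa [powConv] using hb
  | succ m ih =>
    calc ‖powConv ρ (m + 1) b‖ ≤ ‖b‖ * (‖conjRefl b‖ * ‖powConv ρ m b‖) :=
          norm_conv_conv_le ρ _ _ _
      _ ≤ R * (R * R ^ (2 * m + 1)) := by
          gcongr
          exact (norm_conjRefl_le b).trans hb
      _ = R ^ (2 * (m + 1) + 1) := by ring

theorem norm_powConv_sub_le (ρ : ℝ≥0) (m : ℕ) {b c : Coeffs d} {R : ℝ} (hb : ‖b‖ ≤ R)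
    (hc : ‖c‖ ≤ R) :
    ‖powConv ρ m b - powConv ρ m c‖ ≤ (2 * m + 1) * R ^ (2 * m) * ‖b - c‖ := by
  have hR : 0 ≤ R := (norm_nonneg b).trans hb
  induction m with
  | zero => simp [powConv]
  | succ m ih =>
    calc ‖powConv ρ (m + 1) b - powConv ρ (m + 1) c‖
        = ‖conv ρ (b - c) (conv ρ (conjRefl b) (powConv ρ m b)) +
            conv ρ c (conv ρ (conjRefl (b - c)) (powConv ρ m b)) +
            conv ρ c (conv ρ (conjRefl c) (powConv ρ m b - powConv ρ m c))‖ := by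
          simp only [powConv, map_sub, _root_.sub_apply]
          abel_nf
      _ ≤ ‖b - c‖ * (‖conjRefl b‖ * ‖powConv ρ m b‖) +
            ‖c‖ * (‖conjRefl (b - c)‖ * ‖powConv ρ m b‖) +
            ‖c‖ * (‖conjRefl c‖ * ‖powConv ρ m b - powConv ρ m c‖) :=
          norm_add₃_le.trans (by gcongr <;> exact norm_conv_conv_le ρ _ _ _)
      _ ≤ ‖b - c‖ * (R * R ^ (2 * m + 1)) + R * (‖b - c‖ * R ^ (2 * m + 1)) +
            R * (R * ((2 * m + 1) * R ^ (2 * m) * ‖b - c‖)) := by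
          gcongr
          exacts [(norm_conjRefl_le b).trans hb, norm_powConv_le ρ m hb, norm_conjRefl_le _,
            norm_powConv_le ρ m hb, (norm_conjRefl_le c).trans hc]
      _ = (2 * (m + 1 : ℕ) + 1) * R ^ (2 * (m + 1)) * ‖b - c‖ := by push_cast; ring

/-- The action on coefficients of a nonlinearity `F` of degree `2σ + 1`, acting at all radii,
which differs from `μ |u|^{2σ} u` by a multiple of `u`. -/
structure SpectralNonlinearity (d σ : ℕ) (μ : ℝ)
    (F : (EuclideanSpace ℝ (Fin d) → ℂ) → EuclideanSpace ℝ (Fin d) → ℂ) where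
  toFun : ℝ≥0 → Coeffs d → Coeffs d
  const : ℝ
  const_nonneg : 0 ≤ const
  contDiff : ∀ ρ, ContDiff ℝ ∞ (toFun ρ)
  map_zero : ∀ ρ, toFun ρ 0 = 0
  norm_sub_le : ∀ ρ {b c : Coeffs d} {R : ℝ}, ‖b‖ ≤ R → ‖c‖ ≤ R →
    ‖toFun ρ b - toFun ρ c‖ ≤ const * R ^ (2 * σ) * ‖b - c‖
  damp_apply : ∀ θ ρ b, damp θ (toFun (θ + ρ) b) = toFun ρ (damp θ b)
  synth_apply : ∀ {ρ}, 0 < ρ → ∀ b x, synth ρ x (toFun ρ b) = F (fun y => synth ρ y b) x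
  zero_mode : ∀ ρ {b}, b 0 = 0 → toFun ρ b 0 = μ * powConv ρ σ b 0

/-- The nonlinearity `μ |u|^{2σ} u` on coefficients. -/
def spectralPower (d σ : ℕ) (μ : ℝ) :
    SpectralNonlinearity d σ μ (powerNonlinearity d μ σ) where
  toFun ρ b := (μ : ℂ) • powConv ρ σ b
  const := |μ| * (2 * σ + 1)
  const_nonneg := by positivity
  contDiff ρ := contDiff_const.fun_smul (contDiff_powConv ρ σ)
  map_zero ρ := by rw [powConv_zero, smul_zero]
  norm_sub_le ρ b c R hb hc := by
    rw [← smul_sub, norm_smul, Complex.norm_real, Real.norm_eq_abs, mul_assoc |μ|, mul_assoc |μ|]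
    gcongr
    exact norm_powConv_sub_le ρ σ hb hc
  damp_apply θ ρ b := by rw [map_smul, damp_powConv]
  synth_apply _ b x := by
    rw [map_smul, synth_powConv, powerNonlinearity, smul_eq_mul, mul_assoc]
  zero_mode ρ b _ := by simp [-Complex.coe_smul]

/-- The mean of `|u|²`, where `u` has coefficients `b`. -/
def mass (ρ : ℝ≥0) (b : Coeffs d) : ℂ := coord 0 (conv ρ b (conjRefl b))

theorem contDiff_mass (ρ : ℝ≥0) {n : WithTop ℕ∞} : ContDiff ℝ n (mass (d := d) ρ) :=
  contDiff_clm_apply contDiff_const (contDiff_conv ρ contDiff_id conjRefl.contDiff)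

theorem mass_damp (θ ρ : ℝ≥0) (b : Coeffs d) : mass ρ (damp θ b) = mass (θ + ρ) b := by
  rw [mass, mass, ← damp_conjRefl, ← damp_conv, coord_apply, coord_apply, damp_apply,
    weight_zero, Complex.ofReal_one, one_mul]

theorem norm_coord_conv_conjRefl_le (ρ : ℝ≥0) (b c : Coeffs d) :
    ‖coord 0 (conv ρ b (conjRefl c))‖ ≤ ‖b‖ * ‖c‖ :=
  ((norm_apply_le _ 0).trans (norm_conv_le ρ b _)).trans
    (mul_le_mul_of_nonneg_left (norm_conjRefl_le c) (norm_nonneg b))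

theorem norm_mass_smul_sub_le (ρ : ℝ≥0) {b c : Coeffs d} {R : ℝ} (hb : ‖b‖ ≤ R)
    (hc : ‖c‖ ≤ R) : ‖mass ρ b • b - mass ρ c • c‖ ≤ 3 * R ^ 2 * ‖b - c‖ := by
  have hR : 0 ≤ R := (norm_nonneg b).trans hb
  calc ‖mass ρ b • b - mass ρ c • c‖
      = ‖coord 0 (conv ρ (b - c) (conjRefl b)) • b + coord 0 (conv ρ c (conjRefl (b - c))) • b +
          coord 0 (conv ρ c (conjRefl c)) • (b - c)‖ := by
        simp only [mass, map_sub, _root_.sub_apply, sub_smul, smul_sub]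
        abel_nf
    _ ≤ ‖b - c‖ * ‖b‖ * ‖b‖ + ‖c‖ * ‖b - c‖ * ‖b‖ + ‖c‖ * ‖c‖ * ‖b - c‖ := by
        refine norm_add₃_le.trans ?_
        simp only [norm_smul]
        gcongr <;> exact norm_coord_conv_conjRefl_le ρ _ _
    _ ≤ ‖b - c‖ * R * R + R * ‖b - c‖ * R + R * R * ‖b - c‖ := by gcongr
    _ = 3 * R ^ 2 * ‖b - c‖ := by ring

theorem integral_cell_norm_sq_synth {ρ : ℝ≥0} (hρ : 0 < ρ) (b : Coeffs d) :
    ((∫ y in cell d, ‖synth ρ y b‖ ^ 2 : ℝ) : ℂ) = ((2 * Real.pi : ℝ) : ℂ) ^ d * mass ρ b := by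
  have hpi : ((2 * Real.pi : ℝ) : ℂ) ≠ 0 := by exact_mod_cast Real.two_pi_pos.ne'
  have h := fourierCoeff_synth hρ (conv ρ b (conjRefl b)) 0
  simp only [fourierCoeff, synth_conv, synth_conjRefl, Complex.mul_conj', weight_zero,
    Complex.ofReal_one, one_mul, Pi.zero_apply, Int.cast_zero, zero_mul,
    Finset.sum_const_zero, Complex.ofReal_zero, mul_zero, Complex.exp_zero, mul_one] at h
  rw [mass, coord_apply, ← h, ← mul_assoc, ← mul_pow, mul_inv_cancel₀ hpi, one_pow, one_mul,
    ← integral_complex_ofReal]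
  push_cast
  rfl

/-- The renormalized cubic nonlinearity on coefficients. -/
def spectralRenormalized (d : ℕ) (μ : ℝ) :
    SpectralNonlinearity d 1 μ (renormalizedNonlinearity d μ) where
  toFun ρ b := (μ : ℂ) • (powConv ρ 1 b - (2 : ℂ) • mass ρ b • b)
  const := |μ| * 9
  const_nonneg := by positivity
  contDiff ρ := contDiff_const.fun_smul ((contDiff_powConv ρ 1).sub
    (contDiff_const.fun_smul ((contDiff_mass ρ).fun_smul contDiff_id)))
  map_zero ρ := by rw [powConv_zero, smul_zero, smul_zero, sub_zero, smul_zero]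
  norm_sub_le ρ b c R hb hc := by
    rw [← smul_sub, norm_smul, Complex.norm_real, Real.norm_eq_abs, mul_assoc |μ|, mul_assoc |μ|,
      sub_sub_sub_comm, ← smul_sub]
    gcongr
    calc _ ≤ ‖powConv ρ 1 b - powConv ρ 1 c‖ + 2 * ‖mass ρ b • b - mass ρ c • c‖ :=
          (norm_sub_le _ _).trans_eq (by rw [norm_smul, Complex.norm_ofNat])
      _ ≤ (2 * (1 : ℕ) + 1) * R ^ (2 * 1) * ‖b - c‖ + 2 * (3 * R ^ 2 * ‖b - c‖) :=
          add_le_add (norm_powConv_sub_le ρ 1 hb hc)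
            (mul_le_mul_of_nonneg_left (norm_mass_smul_sub_le ρ hb hc) zero_le_two)
      _ = 9 * R ^ (2 * 1) * ‖b - c‖ := by push_cast; ring
  damp_apply θ ρ b := by simp only [map_smul, map_sub, damp_powConv, mass_damp]
  synth_apply hρ b x := by
    have hpi : ((2 * Real.pi : ℝ) : ℂ) ^ d ≠ 0 :=
      pow_ne_zero _ (by exact_mod_cast Real.two_pi_pos.ne')
    simp only [map_smul, map_sub, synth_powConv, renormalizedNonlinearity,
      Complex.ofReal_mul _ (∫ _ in _, _), integral_cell_norm_sq_synth hρ, Complex.ofReal_div,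
      Complex.ofReal_pow (2 * Real.pi), smul_eq_mul]
    field_simp
    push_cast
    ring
  zero_mode ρ b hb := by
    rw [← coord_apply, map_smul, map_sub, map_smul, map_smul, coord_apply, coord_apply, hb,
      smul_zero, smul_zero, sub_zero, smul_eq_mul]

end Nonlinearity

/-! ### Existence of smooth solutions -/

theorem exists_mem_closedBall_and_hasDerivWithinAt {E : Type*} [NormedAddCommGroup E]
    [NormedSpace ℝ E] [CompleteSpace E] {f : ℝ → E → E} {tmin tmax : ℝ} {t₀ : Set.Icc tmin tmax}
    {x₀ x : E} {a r L K : ℝ≥0} (hf : IsPicardLindelof f t₀ x₀ a r L K)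
    (hx : x ∈ Metric.closedBall x₀ r) :
    ∃ α : ℝ → E, α t₀ = x ∧ ∀ t ∈ Set.Icc tmin tmax, α t ∈ Metric.closedBall x₀ a ∧
      HasDerivWithinAt α (f t (α t)) (Set.Icc tmin tmax) t := by
  obtain ⟨α, hα⟩ := ODE.FunSpace.exists_isFixedPt_next hf hx
  have hmem : ∀ t, α.compProj t ∈ Metric.closedBall x₀ a := fun t =>
    α.compProj_mem_closedBall hf.mul_max_le
  refine ⟨α.compProj, by rw [ODE.FunSpace.compProj_val, ← hα, ODE.FunSpace.next_apply₀],
    fun t ht => ⟨hmem t, ?_⟩⟩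
  refine (ODE.hasDerivWithinAt_picard_Icc t₀.2 hf.continuousOn_uncurry
    α.continuous_compProj.continuousOn (fun t _ => hmem t) x ht).congr_of_mem (fun s hs => ?_) ht
  nth_rw 1 [← hα]
  rw [ODE.FunSpace.compProj_of_mem hs, ODE.FunSpace.next_apply]

section Existence

variable {d σ : ℕ} {μ : ℝ}
  {F : (EuclideanSpace ℝ (Fin d) → ℂ) → EuclideanSpace ℝ (Fin d) → ℂ}

namespace SpectralNonlinearity

/-- The vector field of the equation in the interaction picture: if `u` solves the equation, then
`v(t) = e^{-itΔ/2} u(t)` solves `v' = field v`. -/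
def field (S : SpectralNonlinearity d σ μ F) (ρ : ℝ≥0) (t : ℝ) (b : Coeffs d) : Coeffs d :=
  (-Complex.I) • freeGroup (-t) (S.toFun ρ (freeGroup t b))

variable (S : SpectralNonlinearity d σ μ F) (ρ : ℝ≥0)

theorem norm_field_sub_le (t : ℝ) {b c : Coeffs d} {R : ℝ} (hb : ‖b‖ ≤ R) (hc : ‖c‖ ≤ R) :
    ‖S.field ρ t b - S.field ρ t c‖ ≤ S.const * R ^ (2 * σ) * ‖b - c‖ := by
  have hR : 0 ≤ R := (norm_nonneg b).trans hb
  have hK : 0 ≤ S.const * R ^ (2 * σ) := mul_nonneg S.const_nonneg (by positivity)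
  calc ‖S.field ρ t b - S.field ρ t c‖
      = ‖freeGroup (-t) (S.toFun ρ (freeGroup t b) - S.toFun ρ (freeGroup t c))‖ := by
        rw [field, field, ← smul_sub, ← map_sub, norm_smul, norm_neg, Complex.norm_I, one_mul]
    _ ≤ ‖S.toFun ρ (freeGroup t b) - S.toFun ρ (freeGroup t c)‖ := norm_freeGroup_apply_le _ _
    _ ≤ S.const * R ^ (2 * σ) * ‖freeGroup t b - freeGroup t c‖ :=
        S.norm_sub_le ρ ((norm_freeGroup_apply_le t b).trans hb)
          ((norm_freeGroup_apply_le t c).trans hc)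
    _ ≤ S.const * R ^ (2 * σ) * ‖b - c‖ := by
        rw [← map_sub]
        exact mul_le_mul_of_nonneg_left (norm_freeGroup_apply_le t _) hK

theorem norm_field_le (t : ℝ) {b : Coeffs d} {R : ℝ} (hb : ‖b‖ ≤ R) :
    ‖S.field ρ t b‖ ≤ S.const * R ^ (2 * σ) * R := by
  have hR : 0 ≤ R := (norm_nonneg b).trans hb
  have hzero : S.field ρ t 0 = 0 := by simp [field, S.map_zero]
  have h := S.norm_field_sub_le ρ t hb (norm_zero.trans_le hR)
  rw [hzero, sub_zero, sub_zero] at h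
  exact h.trans (mul_le_mul_of_nonneg_left hb (mul_nonneg S.const_nonneg (pow_nonneg hR _)))

theorem continuous_field (b : Coeffs d) : Continuous fun t => S.field ρ t b := by
  have hS : Continuous fun t => S.toFun ρ (freeGroup t b) :=
    (S.contDiff ρ).continuous.comp (continuous_freeGroup_apply b)
  have hpair : Continuous fun t => ((-t, S.toFun ρ (freeGroup t b)) : ℝ × Coeffs d) :=
    continuous_neg.prodMk hS
  have hgroup := (continuous_freeGroup_uncurry (d := d)).comp hpair
  exact (continuous_const_smul (-Complex.I)).comp hgroup

theorem isPicardLindelof_field {φ : Coeffs d} {R T : ℝ≥0} (hφ : ‖φ‖ ≤ R)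
    (hsmall : S.const * (2 * R) ^ (2 * σ) * T * 2 ≤ 1) :
    IsPicardLindelof (S.field ρ) ⟨0, Set.left_mem_Icc.2 T.2⟩ φ R 0
      (⟨S.const, S.const_nonneg⟩ * (2 * R) ^ (2 * σ) * (2 * R))
      (⟨S.const, S.const_nonneg⟩ * (2 * R) ^ (2 * σ)) := by
  have hball : ∀ b ∈ Metric.closedBall φ R, ‖b‖ ≤ 2 * R := fun b hb => by
    linarith [norm_le_norm_add_norm_sub φ b, mem_closedBall_iff_norm'.1 hb]
  refine ⟨fun t _ => LipschitzOnWith.of_dist_le_mul fun b hb c hc => ?_,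
    fun b _ => (S.continuous_field ρ b).continuousOn,
    fun t _ b hb => S.norm_field_le ρ t (hball b hb), ?_⟩
  · rw [dist_eq_norm, dist_eq_norm]
    exact S.norm_field_sub_le ρ t (hball b hb) (hball c hc)
  · change S.const * (2 * R) ^ (2 * σ) * (2 * R) * max (T - 0 : ℝ) (0 - 0) ≤ R - 0
    rw [sub_zero, sub_zero, sub_zero, max_eq_left T.coe_nonneg]
    nlinarith [R.2]

theorem exists_profile {φ : Coeffs d} {R T : ℝ≥0} (hφ : ‖φ‖ ≤ R)
    (hsmall : S.const * (2 * R) ^ (2 * σ) * T * 2 ≤ 1) :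
    ∃ v : ℝ → Coeffs d, v 0 = φ ∧ ∀ t ∈ Set.Icc 0 (T : ℝ), ‖v t‖ ≤ 2 * R ∧
      HasDerivWithinAt v (S.field ρ t (v t)) (Set.Icc 0 (T : ℝ)) t := by
  obtain ⟨v, hv0, hv⟩ := exists_mem_closedBall_and_hasDerivWithinAt
    (S.isPicardLindelof_field ρ hφ hsmall) (Metric.mem_closedBall_self le_rfl)
  refine ⟨v, hv0, fun t ht => ⟨?_, (hv t ht).2⟩⟩
  linarith [norm_le_norm_add_norm_sub φ (v t), mem_closedBall_iff_norm'.1 (hv t ht).1]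

theorem damp_field (η ρ' : ℝ≥0) (t : ℝ) (b : Coeffs d) :
    damp (η + (η + η)) (S.field (η + (η + η) + ρ') t b) =
      (-Complex.I) • ((damp η).comp (freeGroup (-t)))
        (S.toFun (η + ρ') (((damp η).comp (freeGroup t)) (damp η b))) := by
  have hρ : η + (η + η) + ρ' = η + η + (η + ρ') := by ring
  rw [field, map_smul, ← damp_damp, damp_freeGroup (η + η), hρ, S.damp_apply,
    ContinuousLinearMap.comp_apply, ContinuousLinearMap.comp_apply, ← damp_damp η η,
    damp_freeGroup η t]

variable {ρ} {T : ℝ} {v : ℝ → Coeffs d}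

/- Each time derivative costs a factor `|k|²`, paid for by giving up part of the radius `θ`. -/
theorem contDiffOn_damp_profile (hT : 0 < T)
    (hv : ∀ t ∈ Set.Icc 0 T, HasDerivWithinAt v (S.field ρ t (v t)) (Set.Icc 0 T) t) (n : ℕ)
    {θ : ℝ≥0} (hθ : 0 < θ) (hθρ : θ ≤ ρ) :
    ContDiffOn ℝ n (fun t => damp θ (v t)) (Set.Icc 0 T) := by
  have hder : ∀ θ : ℝ≥0, ∀ t ∈ Set.Icc 0 T,
      HasDerivWithinAt (fun t => damp θ (v t)) (damp θ (S.field ρ t (v t))) (Set.Icc 0 T) t :=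
    fun θ t ht => ((damp θ).restrictScalars ℝ).hasFDerivAt.comp_hasDerivWithinAt t (hv t ht)
  induction n generalizing θ with
  | zero => exact contDiffOn_zero.2 fun t ht => (hder θ t ht).continuousWithinAt
  | succ n ih =>
    obtain ⟨η, hη, rfl⟩ : ∃ η : ℝ≥0, 0 < η ∧ θ = η + (η + η) :=
      ⟨θ / 3, by positivity, by rw [← NNReal.coe_inj]; push_cast; ring⟩
    obtain ⟨ρ', rfl⟩ := exists_add_of_le hθρ
    have hηρ : η ≤ η + (η + η) + ρ' := by rw [add_assoc]; exact le_self_add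
    have hgroup : ContDiff ℝ n fun t : ℝ => (damp η).comp (freeGroup (d := d) t) :=
      contDiff_infty.1 (contDiff_damp_comp_freeGroup hη) n
    rw [Nat.cast_succ, contDiffOn_succ_iff_derivWithin (uniqueDiffOn_Icc hT)]
    refine ⟨fun t ht => (hder _ t ht).differentiableWithinAt, by simp,
      ContDiffOn.congr ?_ fun t ht => ((hder _ t ht).derivWithin
        (uniqueDiffOn_Icc hT t ht)).trans (S.damp_field η ρ' t (v t))⟩
    exact contDiffOn_const.fun_smul (contDiffOn_clm_apply
      (hgroup.comp contDiff_neg).contDiffOn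
      ((contDiff_infty.1 (S.contDiff (η + ρ')) n).comp_contDiffOn
        (contDiffOn_clm_apply hgroup.contDiffOn (ih hη hηρ))))

theorem contDiffOn_wave_profile (hT : 0 < T) (hρ : 0 < ρ)
    (hv : ∀ t ∈ Set.Icc 0 T, HasDerivWithinAt v (S.field ρ t (v t)) (Set.Icc 0 T) t) :
    ContDiffOn ℝ ∞ (fun q : ℝ × EuclideanSpace ℝ (Fin d) => wave ρ q (v q.1))
      (Set.Icc 0 T ×ˢ Set.univ) := by
  obtain ⟨η, hη, rfl⟩ : ∃ η : ℝ≥0, 0 < η ∧ ρ = η + η :=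
    ⟨ρ / 2, by positivity, (add_halves ρ).symm⟩
  simp only [← wave_damp]
  have h : ContDiffOn ℝ ∞ (fun t => damp η (v t)) (Set.Icc 0 T) :=
    contDiffOn_infty.2 fun n => S.contDiffOn_damp_profile hT hv n hη le_self_add
  exact contDiffOn_clm_apply (contDiff_wave hη).contDiffOn
    (h.comp contDiff_fst.contDiffOn fun q hq => hq.1)

end SpectralNonlinearity

theorem laplacian_eq_sum_fderiv_fderiv {Y : Type*} [NormedAddCommGroup Y] [NormedSpace ℝ Y]
    {f : EuclideanSpace ℝ (Fin d) → Y} (hf : ContDiff ℝ 2 f) (x : EuclideanSpace ℝ (Fin d)) :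
    Δ f x = ∑ i, fderiv ℝ (fun y => fderiv ℝ f y (EuclideanSpace.single i 1)) x
      (EuclideanSpace.single i 1) := by
  rw [InnerProductSpace.laplacian_eq_iteratedFDeriv_orthonormalBasis f
    (EuclideanSpace.basisFun (Fin d) ℝ)]
  refine Finset.sum_congr rfl fun i _ => ?_
  have hd : DifferentiableAt ℝ (fderiv ℝ f) x :=
    (hf.fderiv_right (m := 1) (by norm_num)).differentiable one_ne_zero x
  rw [iteratedFDeriv_two_apply, fderiv_clm_apply hd (differentiableAt_const _)]
  simp

theorem laplacian_const_mul_cexp (c : ℂ) (k : Fin d → ℤ) (x : EuclideanSpace ℝ (Fin d)) :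
    Δ (fun y => c * Complex.exp (Complex.I * freqForm k y)) x =
      -(2 * dispersion k : ℝ) * (c * Complex.exp (Complex.I * freqForm k x)) := by
  have hsm : ContDiff ℝ 2 fun y => c * Complex.exp (Complex.I * freqForm k y) :=
    contDiff_const.mul (by simpa using contDiff_cexp_smul (freqForm k) (1 : ℂ))
  have hd : ∀ (c : ℂ) (i : Fin d) (y : EuclideanSpace ℝ (Fin d)),
      fderiv ℝ (fun y => c * Complex.exp (Complex.I * freqForm k y)) y
        (EuclideanSpace.single i 1) =
      (Complex.I * k i * c) * Complex.exp (Complex.I * freqForm k y) := fun c i y => by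
    rw [((hasFDerivAt_cexp (freqForm k) y).const_mul c).fderiv]
    simp [freqForm_single]
    ring
  have hsum : ((2 * dispersion k : ℝ) : ℂ) = ∑ i, (k i : ℂ) ^ 2 := by
    rw [dispersion, mul_div_cancel₀ _ two_ne_zero]
    push_cast
    rfl
  rw [laplacian_eq_sum_fderiv_fderiv hsm]
  simp only [hd, hsum, ← Finset.sum_neg_distrib, Finset.sum_mul]
  refine Finset.sum_congr rfl fun i _ => ?_
  linear_combination (k i : ℂ) ^ 2 * c * Complex.exp (Complex.I * freqForm k x) * Complex.I_sq

section FreeEquation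

variable {ρ : ℝ≥0} (hρ : 0 < ρ) (t : ℝ) (x : EuclideanSpace ℝ (Fin d))

include hρ

theorem fderiv_wave_delta (k : Fin d → ℤ) : fderiv ℝ (wave (d := d) ρ) (t, x) (1, 0) (delta k) =
    -Complex.I * dispersion k * wave ρ (t, x) (delta k) := by
  have hwave := ((ContinuousLinearMap.apply ℂ ℂ (delta k)).restrictScalars ℝ).hasFDerivAt.comp
    (t, x) ((contDiff_wave hρ).differentiable (by simp) (t, x)).hasFDerivAt
  have hexp := (hasFDerivAt_cexp (phase k) (t, x)).mul_const (weight ρ k : ℂ)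
  have h := DFunLike.congr_fun (hwave.unique
    (hexp.congr_of_eventuallyEq (.of_forall fun q => wave_delta ρ q k))) (1, 0)
  simp only [ContinuousLinearMap.comp_apply, ContinuousLinearMap.coe_restrictScalars',
    ContinuousLinearMap.apply_apply] at h
  rw [h, wave_delta]
  simp [phase_apply]
  ring

theorem laplacian_wave_apply (b : Coeffs d) : Δ (fun y => wave ρ (t, y) b) x =
    (Δ (fun y : EuclideanSpace ℝ (Fin d) => wave ρ (t, y)) x) b :=
  ((contDiff_infty.1 (contDiff_wave hρ) 2).comp
    (contDiff_const.prodMk contDiff_id)).contDiffAt.laplacian_CLM_comp_left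
      (l := (ContinuousLinearMap.apply ℂ ℂ b).restrictScalars ℝ)

omit hρ in
theorem laplacian_wave_delta (k : Fin d → ℤ) : Δ (fun y => wave ρ (t, y) (delta k)) x =
    -(2 * dispersion k : ℝ) * wave ρ (t, x) (delta k) := by
  have hfun : ∀ y : EuclideanSpace ℝ (Fin d), wave ρ (t, y) (delta k) =
      weight ρ k * Complex.exp (Complex.I * (-(dispersion k * t) : ℝ)) *
        Complex.exp (Complex.I * freqForm k y) := fun y => by
    rw [wave_delta, phase_apply, mul_comm, mul_assoc, ← Complex.exp_add]
    congr 2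
    push_cast
    ring
  simp only [hfun]
  exact laplacian_const_mul_cexp _ k x

theorem wave_free_equation (b : Coeffs d) :
    Complex.I * (fderiv ℝ (wave (d := d) ρ) (t, x) (1, 0)) b +
      (1 / 2 : ℂ) * Δ (fun y => wave ρ (t, y) b) x = 0 := by
  have h : Complex.I • fderiv ℝ (wave (d := d) ρ) (t, x) (1, 0) +
      (1 / 2 : ℂ) • Δ (fun y : EuclideanSpace ℝ (Fin d) => wave ρ (t, y)) x = 0 :=
    hom_ext fun k => by
      simp only [_root_.add_apply, _root_.smul_apply, smul_eq_mul, fderiv_wave_delta hρ,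
        ← laplacian_wave_apply hρ, laplacian_wave_delta, _root_.zero_apply]
      push_cast
      linear_combination (-(dispersion k : ℂ) * wave ρ (t, x) (delta k)) * Complex.I_sq
  simpa [laplacian_wave_apply hρ] using DFunLike.congr_fun h b

theorem hasDerivAt_wave : HasDerivAt (fun τ => wave ρ (τ, x))
    (fderiv ℝ (wave (d := d) ρ) (t, x) (1, 0)) t :=
  HasFDerivAt.comp_hasDerivAt (f := fun τ => (τ, x)) t
    ((contDiff_wave hρ).differentiable (by simp) (t, x)).hasFDerivAt
    ((hasDerivAt_id t).prodMk (hasDerivAt_const t x))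

end FreeEquation

namespace SpectralNonlinearity

variable (S : SpectralNonlinearity d σ μ F) {ρ : ℝ≥0} {T : ℝ} {v : ℝ → Coeffs d}

theorem wave_field (hρ : 0 < ρ) (t : ℝ) (x : EuclideanSpace ℝ (Fin d)) (b : Coeffs d) :
    wave ρ (t, x) (S.field ρ t b) = -Complex.I * F (fun y => wave ρ (t, y) b) x := by
  rw [field, map_smul, ← synth_freeGroup, freeGroup_freeGroup_neg, S.synth_apply hρ, smul_eq_mul]
  simp only [synth_freeGroup]

theorem isSmoothSolution_wave_profile (hT : 0 < T) (hρ : 0 < ρ)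
    (hv : ∀ t ∈ Set.Icc 0 T, HasDerivWithinAt v (S.field ρ t (v t)) (Set.Icc 0 T) t) :
    IsSmoothSolution F T fun t x => wave ρ (t, x) (v t) where
  periodic t _ := by
    simp only [← synth_freeGroup]
    exact isPeriodic_synth ρ _
  smooth := S.contDiffOn_wave_profile hT hρ hv
  equation t ht x := by
    have hd : HasDerivWithinAt (fun τ => wave ρ (τ, x) (v τ))
        ((fderiv ℝ (wave (d := d) ρ) (t, x) (1, 0)) (v t) +
          wave ρ (t, x) (S.field ρ t (v t))) (Set.Icc 0 T) t :=
      ((ContinuousLinearMap.restrictScalarsL ℂ (Coeffs d) ℂ ℝ ℝ).hasFDerivAt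
        |>.comp_hasDerivWithinAt t (hasDerivAt_wave hρ t x).hasDerivWithinAt).clm_apply (hv t ht)
    rw [hd.derivWithin (uniqueDiffOn_Icc hT t ht), S.wave_field hρ]
    linear_combination wave_free_equation hρ t x (v t) -
      F (fun y => wave ρ (t, y) (v t)) x * Complex.I_sq

end SpectralNonlinearity

end Existence

/-! ### Uniqueness of smooth solutions -/

section Cell

variable {d : ℕ}

theorem cell_subset_closure_interior : cell d ⊆ closure (interior (cell d)) := by
  have hconv : Convex ℝ (cell d) := fun x hx y hy a b ha hb hab i =>
    convex_Icc (0 : ℝ) (2 * Real.pi) (hx i) (hy i) ha hb hab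
  have hopen : IsOpen (⋂ i, (fun x : EuclideanSpace ℝ (Fin d) => x i) ⁻¹'
      Set.Ioo 0 (2 * Real.pi)) :=
    isOpen_iInter_of_finite fun i => isOpen_Ioo.preimage (by fun_prop)
  have hne : (interior (cell d)).Nonempty :=
    ⟨WithLp.toLp 2 fun _ => Real.pi, mem_interior.2 ⟨_, fun x hx i =>
      Set.Ioo_subset_Icc_self (Set.mem_iInter.1 hx i), hopen,
      Set.mem_iInter.2 fun i => ⟨Real.pi_pos, lt_two_mul_self Real.pi_pos⟩⟩⟩
  rw [hconv.closure_interior_eq_closure_of_nonempty_interior hne]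
  exact subset_closure

theorem exists_mem_cell_forall_isPeriodic (x : EuclideanSpace ℝ (Fin d)) :
    ∃ y ∈ cell d, ∀ f, IsPeriodic f → f y = f x := by
  set n : Fin d → ℤ := fun i => -⌊x i / (2 * Real.pi)⌋
  refine ⟨x + ∑ i, n i • EuclideanSpace.single i (2 * Real.pi), fun i => ?_, fun f hf => ?_⟩
  · have hxi : (x + ∑ i, n i • EuclideanSpace.single i (2 * Real.pi)) i =
        2 * Real.pi * Int.fract (x i / (2 * Real.pi)) := by
      simp only [PiLp.add_apply, WithLp.ofLp_sum, WithLp.ofLp_smul, Finset.sum_apply,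
        Pi.smul_apply, PiLp.ofLp_single, Pi.single_apply, smul_ite, smul_zero, Finset.sum_ite_eq,
        Finset.mem_univ, if_true, Int.fract, n]
      rw [mul_sub, mul_div_cancel₀ _ Real.two_pi_pos.ne', neg_smul, zsmul_eq_mul]
      ring
    rw [hxi]
    exact ⟨mul_nonneg Real.two_pi_pos.le (Int.fract_nonneg _),
      mul_le_of_le_one_right Real.two_pi_pos.le (Int.fract_lt_one _).le⟩
  · exact Finset.sum_induction _ (fun c => Function.Periodic f c)
      (fun _ _ h₁ h₂ => h₁.add_period h₂) (fun x => by simp)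
      (fun i _ => Function.Periodic.zsmul (hf i) (n i)) x

namespace IsPeriodic

variable {f g : EuclideanSpace ℝ (Fin d) → ℂ}

theorem fderiv_apply (hf : IsPeriodic f) (i : Fin d) (x v : EuclideanSpace ℝ (Fin d)) :
    fderiv ℝ f (x + EuclideanSpace.single i (2 * Real.pi)) v = fderiv ℝ f x v := by
  rw [← fderiv_comp_add_right, funext (hf i)]

theorem eq_of_integral_norm_sq_sub_eq_zero (hf : IsPeriodic f) (hg : IsPeriodic g)
    (hfc : Continuous f) (hgc : Continuous g) (h : ∫ x in cell d, ‖f x - g x‖ ^ 2 = 0) :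
    f = g := by
  have hae : f =ᵐ[volume.restrict (cell d)] g := by
    filter_upwards [(integral_eq_zero_iff_of_nonneg (fun x => sq_nonneg _)
      (integrableOn_cell ((hfc.sub hgc).norm.pow 2))).1 h] with x hx
    exact sub_eq_zero.1 (norm_eq_zero.1 (pow_eq_zero_iff two_ne_zero |>.1 hx))
  have heq := Measure.eqOn_of_ae_eq hae hfc.continuousOn hgc.continuousOn
    cell_subset_closure_interior
  funext x
  obtain ⟨y, hy, hxy⟩ := exists_mem_cell_forall_isPeriodic x
  rw [← hxy f hf, ← hxy g hg, heq hy]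

end IsPeriodic

theorem sq_integral_cell_le {h : EuclideanSpace ℝ (Fin d) → ℝ} (hh : Continuous h) :
    (∫ x in cell d, h x) ^ 2 ≤ (2 * Real.pi) ^ d * ∫ x in cell d, h x ^ 2 := by
  have hV : 0 < (2 * Real.pi) ^ d := pow_pos Real.two_pi_pos d
  have hJensen := even_two.convexOn_pow.map_set_average_le
    (continuous_pow 2).continuousOn isClosed_univ
    (by simpa [volume_cell] using hV) (by simp [volume_cell]) (by simp)
    (integrableOn_cell hh) (integrableOn_cell (hh.pow 2))
  simp only [setAverage_eq, measureReal_def, volume_cell, ENNReal.toReal_ofReal hV.le,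
    smul_eq_mul] at hJensen
  rw [inv_mul_eq_div, inv_mul_eq_div, div_pow, div_le_div_iff₀ (by positivity) hV] at hJensen
  nlinarith

theorem integral_cell_mul_add_integral_le {h : EuclideanSpace ℝ (Fin d) → ℝ}
    (hh : Continuous h) : ∫ x in cell d, h x * (h x + ∫ y in cell d, h y) ≤
      (1 + (2 * Real.pi) ^ d) * ∫ x in cell d, h x ^ 2 := by
  simp only [mul_add, ← sq]
  have hsq : IntegrableOn (fun x => h x ^ 2) (cell d) := integrableOn_cell (hh.pow 2)
  rw [integral_add hsq ((integrableOn_cell hh).mul_const _), integral_mul_const, ← sq, add_mul,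
    one_mul]
  gcongr
  exact sq_integral_cell_le hh

end Cell

section EnergyEstimate

variable {d : ℕ} {u v : EuclideanSpace ℝ (Fin d) → ℂ}

theorem continuous_fderiv_fderiv_apply (hu : ContDiff ℝ 2 u) (v w : EuclideanSpace ℝ (Fin d)) :
    Continuous fun x => fderiv ℝ (fun y => fderiv ℝ u y v) x w :=
  (((hu.fderiv_right (m := 1) (by norm_num)).clm_apply contDiff_const).continuous_fderiv
    one_ne_zero).clm_apply continuous_const

theorem continuous_laplacian (hu : ContDiff ℝ 2 u) : Continuous (Δ u) := by
  rw [funext (laplacian_eq_sum_fderiv_fderiv hu)]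
  exact continuous_finsetSum _ fun i _ => continuous_fderiv_fderiv_apply hu _ _

theorem integral_cell_fderiv_fderiv_mul_conj (hu : ContDiff ℝ 2 u) (hper : IsPeriodic u)
    (i : Fin d) :
    ∫ x in cell d, fderiv ℝ (fun y => fderiv ℝ u y (EuclideanSpace.single i 1)) x
        (EuclideanSpace.single i 1) * (starRingEnd ℂ) (u x) =
      -((∫ x in cell d, ‖fderiv ℝ u x (EuclideanSpace.single i 1)‖ ^ 2 : ℝ) : ℂ) := by
  set e : EuclideanSpace ℝ (Fin d) := EuclideanSpace.single i 1
  have hu1 : ContDiff ℝ 1 u := hu.of_le one_le_two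
  have hD : ContDiff ℝ 1 fun x => fderiv ℝ u x e :=
    (hu.fderiv_right (m := 1) (by norm_num)).clm_apply contDiff_const
  have hconj : ContDiff ℝ 1 fun x => (starRingEnd ℂ) (u x) := Complex.conjCLE.contDiff.comp hu1
  have hDconj : ∀ x, fderiv ℝ (fun x => (starRingEnd ℂ) (u x)) x e =
      (starRingEnd ℂ) (fderiv ℝ u x e) := fun x => DFunLike.congr_fun
    ((Complex.conjCLE.toContinuousLinearMap.hasFDerivAt (x := u x)).comp x
      (hu1.differentiable one_ne_zero x).hasFDerivAt).fderiv e
  have hprod : ∀ x, fderiv ℝ (fun x => fderiv ℝ u x e * (starRingEnd ℂ) (u x)) x e =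
      fderiv ℝ (fun y => fderiv ℝ u y e) x e * (starRingEnd ℂ) (u x) +
        ((‖fderiv ℝ u x e‖ ^ 2 : ℝ) : ℂ) := fun x => by
    rw [fderiv_fun_mul (hD.differentiable one_ne_zero x) (hconj.differentiable one_ne_zero x)]
    simp only [_root_.add_apply, _root_.smul_apply, smul_eq_mul, hDconj, Complex.mul_conj',
      Complex.ofReal_pow]
    ring
  have hint : IntegrableOn (fun x => fderiv ℝ (fun y => fderiv ℝ u y e) x e *
      (starRingEnd ℂ) (u x)) (cell d) :=
    integrableOn_cell ((continuous_fderiv_fderiv_apply hu e e).mul hconj.continuous)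
  have hint_sq : IntegrableOn (fun x => ((‖fderiv ℝ u x e‖ ^ 2 : ℝ) : ℂ)) (cell d) :=
    integrableOn_cell (Complex.continuous_ofReal.comp (hD.continuous.norm.pow 2))
  rw [← integral_complex_ofReal]
  refine eq_neg_of_add_eq_zero_left ((integral_add hint hint_sq).symm.trans ?_)
  simp only [← hprod]
  exact integral_cell_fderiv_eq_zero (hD.mul hconj)
    (fun j x => by simp only [hper.fderiv_apply, hper j x]) i

theorem integral_cell_laplacian_mul_conj_im (hu : ContDiff ℝ 2 u) (hper : IsPeriodic u) :
    ∫ x in cell d, (Δ u x * (starRingEnd ℂ) (u x)).im = 0 := by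
  have hconj : Continuous fun x => (starRingEnd ℂ) (u x) :=
    Complex.continuous_conj.comp hu.continuous
  have hint : IntegrableOn (fun x => Δ u x * (starRingEnd ℂ) (u x)) (cell d) :=
    integrableOn_cell ((continuous_laplacian hu).mul hconj)
  refine (integral_im hint).trans ?_
  simp only [laplacian_eq_sum_fderiv_fderiv hu, Finset.sum_mul]
  rw [integral_finsetSum]
  · simp [integral_cell_fderiv_fderiv_mul_conj hu hper, -Complex.ofReal_pow]
  · exact fun i _ => integrableOn_cell ((continuous_fderiv_fderiv_apply hu _ _).mul hconj)

theorem integral_cell_re_mul_conj (hu : ContDiff ℝ 2 u) (hper : IsPeriodic u)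
    (hv : Continuous v) : ∫ x in cell d, (v x * (starRingEnd ℂ) (u x)).re =
      ∫ x in cell d, ((Complex.I * v x + 1 / 2 * Δ u x) * (starRingEnd ℂ) (u x)).im := by
  have hconj : Continuous fun x => (starRingEnd ℂ) (u x) :=
    Complex.continuous_conj.comp hu.continuous
  have hsplit : ∀ x, ((Complex.I * v x + 1 / 2 * Δ u x) * (starRingEnd ℂ) (u x)).im =
      (v x * (starRingEnd ℂ) (u x)).re + 1 / 2 * (Δ u x * (starRingEnd ℂ) (u x)).im := fun x => by
    rw [add_mul, mul_assoc, mul_assoc, Complex.add_im, Complex.I_mul_im,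
      ← Complex.im_ofReal_mul]
    push_cast
    rfl
  have hint : IntegrableOn (fun x => (v x * (starRingEnd ℂ) (u x)).re) (cell d) :=
    integrableOn_cell (Complex.continuous_re.comp (hv.mul hconj))
  have hint_lap : IntegrableOn (fun x => (Δ u x * (starRingEnd ℂ) (u x)).im) (cell d) :=
    integrableOn_cell (Complex.continuous_im.comp ((continuous_laplacian hu).mul hconj))
  simp only [hsplit]
  rw [integral_add hint (hint_lap.const_mul _), integral_const_mul,
    integral_cell_laplacian_mul_conj_im hu hper, mul_zero, add_zero]

theorem integral_cell_re_mul_conj_le (hu : ContDiff ℝ 2 u) (hper : IsPeriodic u)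
    (hv : Continuous v) {C : ℝ} (hC : 0 ≤ C) (h : ∀ x ∈ cell d,
      ‖Complex.I * v x + 1 / 2 * Δ u x‖ ≤ C * (‖u x‖ + ∫ y in cell d, ‖u y‖)) :
    ∫ x in cell d, (v x * (starRingEnd ℂ) (u x)).re ≤
      C * (1 + (2 * Real.pi) ^ d) * ∫ x in cell d, ‖u x‖ ^ 2 := by
  have hlap := continuous_laplacian hu
  have huc := hu.continuous
  calc ∫ x in cell d, (v x * (starRingEnd ℂ) (u x)).re
      = ∫ x in cell d, ((Complex.I * v x + 1 / 2 * Δ u x) * (starRingEnd ℂ) (u x)).im :=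
        integral_cell_re_mul_conj hu hper hv
    _ ≤ ∫ x in cell d, C * (‖u x‖ * (‖u x‖ + ∫ y in cell d, ‖u y‖)) := by
        refine setIntegral_mono_on (integrableOn_cell (Complex.continuous_im.comp
          (((continuous_const.mul hv).add (continuous_const.mul hlap)).mul
            (Complex.continuous_conj.comp huc)))) (integrableOn_cell (by fun_prop))
          measurableSet_cell fun x hx => (Complex.im_le_norm _).trans ?_
        rw [norm_mul, RCLike.norm_conj, mul_comm, mul_left_comm]
        exact mul_le_mul_of_nonneg_left (h x hx) (norm_nonneg _)
    _ ≤ C * (1 + (2 * Real.pi) ^ d) * ∫ x in cell d, ‖u x‖ ^ 2 := by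
        rw [integral_const_mul, mul_assoc]
        exact mul_le_mul_of_nonneg_left (integral_cell_mul_add_integral_le huc.norm) hC

end EnergyEstimate

section Slab

variable {d : ℕ} {T : ℝ} {w : ℝ → EuclideanSpace ℝ (Fin d) → ℂ}

/-- The time derivative, one-sided at the end points, of a function on `[0, T] × ℝ^d`. -/
def timeDeriv (T : ℝ) (w : ℝ → EuclideanSpace ℝ (Fin d) → ℂ) (t : ℝ)
    (x : EuclideanSpace ℝ (Fin d)) : ℂ :=
  derivWithin (fun τ => w τ x) (Set.Icc 0 T) t

theorem continuous_slice {f : ℝ × EuclideanSpace ℝ (Fin d) → ℂ}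
    (hf : ContinuousOn f (Set.Icc 0 T ×ˢ Set.univ)) {t : ℝ} (ht : t ∈ Set.Icc 0 T) :
    Continuous fun x => f (t, x) :=
  continuousOn_univ.1 (hf.comp (by fun_prop) fun _ _ => ⟨ht, trivial⟩)

theorem exists_norm_le_of_continuousOn_slab {f : ℝ × EuclideanSpace ℝ (Fin d) → ℂ}
    (hf : ContinuousOn f (Set.Icc 0 T ×ˢ Set.univ)) :
    ∃ M, ∀ t ∈ Set.Icc 0 T, ∀ x ∈ cell d, ‖f (t, x)‖ ≤ M := by
  obtain ⟨M, hM⟩ := (isCompact_Icc.prod (isCompact_cell (d := d))).exists_bound_of_continuousOn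
    (hf.mono (Set.prod_mono_right (Set.subset_univ _)))
  exact ⟨M, fun t ht x hx => hM (t, x) ⟨ht, hx⟩⟩

theorem continuousOn_integral_cell_norm_sq
    (hw : ContinuousOn (fun q : ℝ × EuclideanSpace ℝ (Fin d) => w q.1 q.2)
      (Set.Icc 0 T ×ˢ Set.univ)) :
    ContinuousOn (fun t => ∫ x in cell d, ‖w t x‖ ^ 2) (Set.Icc 0 T) := by
  obtain ⟨M, hM⟩ := exists_norm_le_of_continuousOn_slab hw
  refine continuousOn_of_dominated (bound := fun _ => M ^ 2)
    (fun t ht => ((continuous_slice hw ht).norm.pow 2).aestronglyMeasurable) (fun t ht => ?_)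
    (integrableOn_cell continuous_const) (.of_forall fun x => ?_)
  · refine (ae_restrict_iff' measurableSet_cell).2 (.of_forall fun x hx => ?_)
    rw [Real.norm_of_nonneg (by positivity)]
    exact pow_le_pow_left₀ (norm_nonneg _) (hM t ht x hx) 2
  · exact (hw.comp (by fun_prop : Continuous fun t : ℝ => (t, x)).continuousOn
      fun t ht => ⟨ht, trivial⟩).norm.pow 2

variable (hw : ContDiffOn ℝ 1 (fun q : ℝ × EuclideanSpace ℝ (Fin d) => w q.1 q.2)
  (Set.Icc 0 T ×ˢ Set.univ))

include hw

theorem hasDerivWithinAt_fderivWithin_slab {t : ℝ} (ht : t ∈ Set.Icc 0 T)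
    (x : EuclideanSpace ℝ (Fin d)) : HasDerivWithinAt (fun τ => w τ x)
      (fderivWithin ℝ (fun q : ℝ × EuclideanSpace ℝ (Fin d) => w q.1 q.2)
        (Set.Icc 0 T ×ˢ Set.univ) (t, x) (1, 0)) (Set.Icc 0 T) t :=
  (hw.differentiableOn one_ne_zero (t, x) ⟨ht, trivial⟩).hasFDerivWithinAt.comp_hasDerivWithinAt
    (f := fun τ => (τ, x)) t ((hasDerivAt_id t).prodMk (hasDerivAt_const t x)).hasDerivWithinAt
    fun _ hτ => ⟨hτ, trivial⟩

theorem hasDerivWithinAt_timeDeriv {t : ℝ} (ht : t ∈ Set.Icc 0 T)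
    (x : EuclideanSpace ℝ (Fin d)) :
    HasDerivWithinAt (fun τ => w τ x) (timeDeriv T w t x) (Set.Icc 0 T) t :=
  (hasDerivWithinAt_fderivWithin_slab hw ht x).differentiableWithinAt.hasDerivWithinAt

theorem continuousOn_timeDeriv (hT : 0 < T) :
    ContinuousOn (fun q : ℝ × EuclideanSpace ℝ (Fin d) => timeDeriv T w q.1 q.2)
      (Set.Icc 0 T ×ˢ Set.univ) :=
  ((hw.continuousOn_fderivWithin ((uniqueDiffOn_Icc hT).prod uniqueDiffOn_univ)
    le_rfl).clm_apply continuousOn_const).congr fun q hq =>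
      (hasDerivWithinAt_fderivWithin_slab hw hq.1 q.2).derivWithin
        (uniqueDiffOn_Icc hT q.1 hq.1)

theorem hasDerivAt_integral_cell_norm_sq {t : ℝ} (ht : t ∈ Set.Ioo 0 T) :
    HasDerivAt (fun τ => ∫ x in cell d, ‖w τ x‖ ^ 2)
      (2 * ∫ x in cell d, (timeDeriv T w t x * (starRingEnd ℂ) (w t x)).re) t := by
  have hdw := continuousOn_timeDeriv hw (ht.1.trans ht.2)
  have hsub : ∀ τ ∈ Set.Ioo 0 T, τ ∈ Set.Icc 0 T := Set.Ioo_subset_Icc_self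
  obtain ⟨M, hM⟩ := exists_norm_le_of_continuousOn_slab hw.continuousOn
  obtain ⟨K, hK⟩ := exists_norm_le_of_continuousOn_slab hdw
  have hcont : ∀ τ ∈ Set.Ioo 0 T, Continuous (w τ) := fun τ hτ =>
    continuous_slice hw.continuousOn (hsub τ hτ)
  rw [← integral_const_mul]
  refine (hasDerivAt_integral_of_dominated_loc_of_deriv_le (bound := fun _ => 2 * (K * M))
    (F' := fun τ x => 2 * (timeDeriv T w τ x * (starRingEnd ℂ) (w τ x)).re)
    (Ioo_mem_nhds ht.1 ht.2) ?_ (integrableOn_cell ((hcont t ht).norm.pow 2)) ?_ ?_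
    (integrableOn_cell continuous_const) (.of_forall fun x τ hτ => ?_)).2
  · filter_upwards [Ioo_mem_nhds ht.1 ht.2] with τ hτ
    exact ((hcont τ hτ).norm.pow 2).aestronglyMeasurable
  · exact (continuous_const.mul (Complex.continuous_re.comp ((continuous_slice hdw (hsub t ht)).mul
      (Complex.continuous_conj.comp (hcont t ht))))).aestronglyMeasurable
  · refine (ae_restrict_iff' measurableSet_cell).2 (.of_forall fun x hx τ hτ => ?_)
    rw [norm_mul, Real.norm_ofNat, Real.norm_eq_abs]
    refine mul_le_mul_of_nonneg_left ((Complex.abs_re_le_norm _).trans ?_) zero_le_two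
    rw [norm_mul, RCLike.norm_conj]
    have hKx := hK τ (hsub τ hτ) x hx
    exact mul_le_mul hKx (hM τ (hsub τ hτ) x hx) (norm_nonneg _) ((norm_nonneg _).trans hKx)
  · exact ((hasDerivWithinAt_timeDeriv hw (hsub τ hτ) x).hasDerivAt
      (Icc_mem_nhds hτ.1 hτ.2)).norm_sq

end Slab

theorem eq_zero_of_hasDerivAt_le_mul {f f' : ℝ → ℝ} {a b K : ℝ}
    (hf : ContinuousOn f (Set.Icc a b)) (hf' : ∀ t ∈ Set.Ioo a b, HasDerivAt f (f' t) t)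
    (hle : ∀ t ∈ Set.Ioo a b, f' t ≤ K * f t) (ha : f a = 0)
    (hnonneg : ∀ t ∈ Set.Icc a b, 0 ≤ f t) {t : ℝ} (ht : t ∈ Set.Icc a b) : f t = 0 := by
  have hexp : ∀ t, HasDerivAt (fun t => Real.exp (-K * t)) (Real.exp (-K * t) * -K) t := fun t => by
    simpa using ((hasDerivAt_id t).const_mul (-K)).exp
  have hanti : AntitoneOn (fun t => Real.exp (-K * t) * f t) (Set.Icc a b) := by
    refine antitoneOn_of_hasDerivWithinAt_nonpos (convex_Icc a b)
      ((by fun_prop : Continuous fun t : ℝ => Real.exp (-K * t)).continuousOn.mul hf)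
      (fun t ht => ((hexp t).mul (hf' t ?_)).hasDerivWithinAt) fun t ht => ?_
    · rwa [interior_Icc] at ht
    · rw [interior_Icc] at ht
      nlinarith [Real.exp_pos (-K * t), hle t ht]
  have h := hanti (Set.left_mem_Icc.2 (ht.1.trans ht.2)) ht ht.1
  simp only [ha, mul_zero] at h
  exact le_antisymm (nonpos_of_mul_nonpos_right h (Real.exp_pos _)) (hnonneg t ht)

section Uniqueness

variable {d : ℕ} {F : (EuclideanSpace ℝ (Fin d) → ℂ) → EuclideanSpace ℝ (Fin d) → ℂ} {T : ℝ}
  {χ ψ : ℝ → EuclideanSpace ℝ (Fin d) → ℂ}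

/-- On sets of functions that are bounded on the period cell, `F` is Lipschitz up to the mean of
the difference. Nonlinearities with coefficients depending on the mass of `f` satisfy this, while
they are not pointwise Lipschitz. -/
def IsMeanLipschitz (F : (EuclideanSpace ℝ (Fin d) → ℂ) → EuclideanSpace ℝ (Fin d) → ℂ) : Prop :=
  ∀ M : ℝ, ∃ C : ℝ, 0 ≤ C ∧ ∀ f g : EuclideanSpace ℝ (Fin d) → ℂ, Continuous f → Continuous g →
    (∀ x ∈ cell d, ‖f x‖ ≤ M) → (∀ x ∈ cell d, ‖g x‖ ≤ M) →
    ∀ x ∈ cell d, ‖F f x - F g x‖ ≤ C * (‖f x - g x‖ + ∫ y in cell d, ‖f y - g y‖)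

namespace IsSmoothSolution

theorem contDiff (h : IsSmoothSolution F T χ) {t : ℝ} (ht : t ∈ Set.Icc 0 T) :
    ContDiff ℝ ∞ (χ t) :=
  contDiffOn_univ.1 (h.smooth.comp (f := fun x : EuclideanSpace ℝ (Fin d) => (t, x))
    (contDiff_const.prodMk contDiff_id).contDiffOn fun _ _ => ⟨ht, trivial⟩)

theorem equation_sub (hχ : IsSmoothSolution F T χ) (hψ : IsSmoothSolution F T ψ) (hT : 0 < T)
    {t : ℝ} (ht : t ∈ Set.Icc 0 T) (x : EuclideanSpace ℝ (Fin d)) :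
    Complex.I * timeDeriv T (χ - ψ) t x + 1 / 2 * Δ (χ t - ψ t) x = F (χ t) x - F (ψ t) x := by
  have hlap : Δ (χ t - ψ t) x = Δ (χ t) x - Δ (ψ t) x :=
    (contDiff_infty.1 (hχ.contDiff ht) 2).contDiffAt.laplacian_sub
      (contDiff_infty.1 (hψ.contDiff ht) 2).contDiffAt
  have hder : timeDeriv T (χ - ψ) t x = timeDeriv T χ t x - timeDeriv T ψ t x :=
    ((hasDerivWithinAt_timeDeriv (hχ.smooth.of_le (by simp)) ht x).sub
      (hasDerivWithinAt_timeDeriv (hψ.smooth.of_le (by simp)) ht x)).derivWithin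
        (uniqueDiffOn_Icc hT t ht)
  rw [hlap, hder, ← hχ.equation t ht x, ← hψ.equation t ht x, timeDeriv, timeDeriv]
  ring

theorem unique (hF : IsMeanLipschitz F) (hT : 0 < T) (hχ : IsSmoothSolution F T χ)
    (hψ : IsSmoothSolution F T ψ) (h0 : χ 0 = ψ 0) {t : ℝ} (ht : t ∈ Set.Icc 0 T) :
    χ t = ψ t := by
  obtain ⟨M₁, hM₁⟩ := exists_norm_le_of_continuousOn_slab hχ.smooth.continuousOn
  obtain ⟨M₂, hM₂⟩ := exists_norm_le_of_continuousOn_slab hψ.smooth.continuousOn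
  obtain ⟨C, hC0, hC⟩ := hF (max M₁ M₂)
  have hw : ContDiffOn ℝ 1 (fun q : ℝ × EuclideanSpace ℝ (Fin d) => (χ - ψ) q.1 q.2)
      (Set.Icc 0 T ×ˢ Set.univ) := (hχ.smooth.sub hψ.smooth).of_le (by simp)
  have henergy : ∀ t ∈ Set.Ioo 0 T,
      2 * ∫ x in cell d, (timeDeriv T (χ - ψ) t x * (starRingEnd ℂ) ((χ - ψ) t x)).re ≤
        2 * (C * (1 + (2 * Real.pi) ^ d)) * ∫ x in cell d, ‖(χ - ψ) t x‖ ^ 2 := fun t ht => by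
    have htc := Set.Ioo_subset_Icc_self ht
    rw [mul_assoc 2]
    refine mul_le_mul_of_nonneg_left (integral_cell_re_mul_conj_le (u := χ t - ψ t)
      ((contDiff_infty.1 (hχ.contDiff htc) 2).sub (contDiff_infty.1 (hψ.contDiff htc) 2))
      (fun i x => ?_) (continuous_slice (continuousOn_timeDeriv hw hT) htc) hC0
      fun x hx => ?_) zero_le_two
    · rw [Pi.sub_apply, Pi.sub_apply, hχ.periodic t htc i x, hψ.periodic t htc i x]
    · refine (congrArg norm (hχ.equation_sub hψ hT htc x)).trans_le ?_
      exact hC _ _ (hχ.contDiff htc).continuous (hψ.contDiff htc).continuous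
        (fun x hx => (hM₁ t htc x hx).trans (le_max_left _ _))
        (fun x hx => (hM₂ t htc x hx).trans (le_max_right _ _)) x hx
  refine (hχ.periodic t ht).eq_of_integral_norm_sq_sub_eq_zero (hψ.periodic t ht)
    (hχ.contDiff ht).continuous (hψ.contDiff ht).continuous ?_
  exact eq_zero_of_hasDerivAt_le_mul (continuousOn_integral_cell_norm_sq hw.continuousOn)
    (fun t ht => hasDerivAt_integral_cell_norm_sq hw ht) henergy (by simp [h0])
    (fun t _ => integral_nonneg fun x => sq_nonneg _) ht

end IsSmoothSolution

end Uniqueness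

theorem norm_norm_pow_mul_sub_le (m : ℕ) {z w : ℂ} {M : ℝ} (hz : ‖z‖ ≤ M) (hw : ‖w‖ ≤ M) :
    ‖((‖z‖ ^ (2 * m) : ℝ) : ℂ) * z - ((‖w‖ ^ (2 * m) : ℝ) : ℂ) * w‖ ≤
      (2 * m + 1) * M ^ (2 * m) * ‖z - w‖ := by
  have hM : 0 ≤ M := (norm_nonneg z).trans hz
  have hpow : |‖z‖ ^ (2 * m) - ‖w‖ ^ (2 * m)| * M ≤ 2 * m * M ^ (2 * m) * ‖z - w‖ := by
    rcases m with _ | m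
    · simp
    calc |‖z‖ ^ (2 * (m + 1)) - ‖w‖ ^ (2 * (m + 1))| * M
        ≤ |‖z‖ - ‖w‖| * (2 * (m + 1) : ℕ) * max |‖z‖| |‖w‖| ^ (2 * (m + 1) - 1) * M := by
          gcongr
          exact abs_pow_sub_pow_le ‖z‖ ‖w‖ (2 * (m + 1))
      _ ≤ ‖z - w‖ * (2 * (m + 1) : ℕ) * M ^ (2 * m + 1) * M := by
          rw [abs_norm, abs_norm, show 2 * (m + 1) - 1 = 2 * m + 1 by lia]
          gcongr
          exacts [abs_norm_sub_norm_le z w, max_le hz hw]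
      _ = 2 * (m + 1 : ℕ) * M ^ (2 * (m + 1)) * ‖z - w‖ := by push_cast; ring
  calc ‖((‖z‖ ^ (2 * m) : ℝ) : ℂ) * z - ((‖w‖ ^ (2 * m) : ℝ) : ℂ) * w‖
      = ‖((‖z‖ ^ (2 * m) : ℝ) : ℂ) * (z - w) +
          ((‖z‖ ^ (2 * m) - ‖w‖ ^ (2 * m) : ℝ) : ℂ) * w‖ := by
        push_cast
        ring_nf
    _ ≤ ‖z‖ ^ (2 * m) * ‖z - w‖ + |‖z‖ ^ (2 * m) - ‖w‖ ^ (2 * m)| * ‖w‖ := by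
        refine (norm_add_le _ _).trans_eq ?_
        rw [norm_mul, norm_mul, Complex.norm_real, Complex.norm_real, Real.norm_eq_abs,
          Real.norm_eq_abs, abs_of_nonneg (by positivity : (0 : ℝ) ≤ ‖z‖ ^ (2 * m))]
    _ ≤ M ^ (2 * m) * ‖z - w‖ + 2 * m * M ^ (2 * m) * ‖z - w‖ := by
        refine add_le_add (by gcongr) (le_trans (by gcongr) hpow)
    _ = (2 * m + 1) * M ^ (2 * m) * ‖z - w‖ := by ring

section MeanLipschitz

variable {d : ℕ} {F G : (EuclideanSpace ℝ (Fin d) → ℂ) → EuclideanSpace ℝ (Fin d) → ℂ}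

theorem IsMeanLipschitz.sub (hF : IsMeanLipschitz F) (hG : IsMeanLipschitz G) :
    IsMeanLipschitz fun f x => F f x - G f x := by
  intro M
  obtain ⟨C, hC0, hC⟩ := hF M
  obtain ⟨C', hC0', hC'⟩ := hG M
  refine ⟨C + C', add_nonneg hC0 hC0', fun f g hf hg hfM hgM x hx => ?_⟩
  rw [sub_sub_sub_comm, add_mul]
  exact (norm_sub_le _ _).trans
    (add_le_add (hC f g hf hg hfM hgM x hx) (hC' f g hf hg hfM hgM x hx))

theorem isMeanLipschitz_powerNonlinearity (μ : ℝ) (σ : ℕ) :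
    IsMeanLipschitz (powerNonlinearity d μ σ) := by
  refine fun M => ⟨|μ| * ((2 * σ + 1) * M ^ (2 * σ)), mul_nonneg (abs_nonneg μ)
    (mul_nonneg (by positivity) ((even_two_mul σ).pow_nonneg M)),
    fun f g _ _ hfM hgM x hx => ?_⟩
  have hmean : 0 ≤ ∫ y in cell d, ‖f y - g y‖ := integral_nonneg fun y => norm_nonneg _
  have hM : 0 ≤ M ^ (2 * σ) := (even_two_mul σ).pow_nonneg M
  calc ‖powerNonlinearity d μ σ f x - powerNonlinearity d μ σ g x‖
      = |μ| * ‖((‖f x‖ ^ (2 * σ) : ℝ) : ℂ) * f x - ((‖g x‖ ^ (2 * σ) : ℝ) : ℂ) * g x‖ := by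
        rw [powerNonlinearity, powerNonlinearity, mul_assoc, mul_assoc, ← mul_sub, norm_mul,
          Complex.norm_real, Real.norm_eq_abs]
    _ ≤ |μ| * ((2 * σ + 1) * M ^ (2 * σ) * ‖f x - g x‖) := by
        gcongr
        exact norm_norm_pow_mul_sub_le σ (hfM x hx) (hgM x hx)
    _ ≤ |μ| * ((2 * σ + 1) * M ^ (2 * σ)) * (‖f x - g x‖ + ∫ y in cell d, ‖f y - g y‖) := by
        rw [← mul_assoc]
        gcongr
        exact le_add_of_nonneg_right hmean

variable {f g : EuclideanSpace ℝ (Fin d) → ℂ} {M : ℝ}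

theorem integral_cell_norm_sq_le (hf : Continuous f) (hfM : ∀ x ∈ cell d, ‖f x‖ ≤ M) :
    ∫ x in cell d, ‖f x‖ ^ 2 ≤ (2 * Real.pi) ^ d * M ^ 2 := by
  calc ∫ x in cell d, ‖f x‖ ^ 2 ≤ ∫ _ in cell d, M ^ 2 :=
        setIntegral_mono_on (integrableOn_cell (by fun_prop)) (integrableOn_cell continuous_const)
          measurableSet_cell fun x hx => pow_le_pow_left₀ (norm_nonneg _) (hfM x hx) 2
    _ = (2 * Real.pi) ^ d * M ^ 2 := by
        simp [measureReal_def, volume_cell, ENNReal.toReal_ofReal,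
          pow_nonneg Real.two_pi_pos.le]

theorem abs_integral_cell_norm_sq_sub_le (hf : Continuous f) (hg : Continuous g)
    (hfM : ∀ x ∈ cell d, ‖f x‖ ≤ M) (hgM : ∀ x ∈ cell d, ‖g x‖ ≤ M) :
    |(∫ x in cell d, ‖f x‖ ^ 2) - ∫ x in cell d, ‖g x‖ ^ 2| ≤
      2 * M * ∫ x in cell d, ‖f x - g x‖ := by
  rw [← integral_sub (integrableOn_cell (by fun_prop)) (integrableOn_cell (by fun_prop)),
    ← integral_const_mul, ← Real.norm_eq_abs]
  refine (norm_integral_le_integral_norm _).trans (setIntegral_mono_on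
    (integrableOn_cell (by fun_prop)) (integrableOn_cell (by fun_prop)) measurableSet_cell
    fun x hx => ?_)
  rw [Real.norm_eq_abs, sq_sub_sq, abs_mul, abs_of_nonneg (by positivity), two_mul M]
  exact mul_le_mul (add_le_add (hfM x hx) (hgM x hx)) (abs_norm_sub_norm_le _ _) (abs_nonneg _)
    (add_nonneg ((norm_nonneg _).trans (hfM x hx)) ((norm_nonneg _).trans (hgM x hx)))

theorem isMeanLipschitz_integral_norm_sq_mul (c : ℝ) :
    IsMeanLipschitz (d := d) fun f x => ((c * ∫ y in cell d, ‖f y‖ ^ 2 : ℝ) : ℂ) * f x := by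
  refine fun M => ⟨|c| * ((2 * Real.pi) ^ d * M ^ 2 + 2 * M ^ 2), by positivity,
    fun f g hf hg hfM hgM x hx => ?_⟩
  have hM : 0 ≤ M := (norm_nonneg _).trans (hfM x hx)
  have hmean : 0 ≤ ∫ y in cell d, ‖f y - g y‖ := integral_nonneg fun y => norm_nonneg _
  have hmass : |∫ y in cell d, ‖f y‖ ^ 2| ≤ (2 * Real.pi) ^ d * M ^ 2 := by
    rw [abs_of_nonneg (integral_nonneg fun y => by positivity)]
    exact integral_cell_norm_sq_le hf hfM
  have hdiff := abs_integral_cell_norm_sq_sub_le hf hg hfM hgM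
  set mf := ∫ y in cell d, ‖f y‖ ^ 2
  set mg := ∫ y in cell d, ‖g y‖ ^ 2
  set J := ∫ y in cell d, ‖f y - g y‖
  calc ‖((c * mf : ℝ) : ℂ) * f x - ((c * mg : ℝ) : ℂ) * g x‖
      = ‖((c * mf : ℝ) : ℂ) * (f x - g x) + ((c * (mf - mg) : ℝ) : ℂ) * g x‖ := by
        push_cast
        ring_nf
    _ ≤ |c| * |mf| * ‖f x - g x‖ + |c| * |mf - mg| * ‖g x‖ := by
        refine (norm_add_le _ _).trans_eq ?_
        rw [norm_mul, norm_mul, Complex.norm_real, Complex.norm_real, Real.norm_eq_abs,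
          Real.norm_eq_abs, abs_mul, abs_mul]
    _ ≤ |c| * ((2 * Real.pi) ^ d * M ^ 2) * ‖f x - g x‖ + |c| * (2 * M * J) * M := by
        gcongr
        exact hgM x hx
    _ ≤ |c| * ((2 * Real.pi) ^ d * M ^ 2 + 2 * M ^ 2) * (‖f x - g x‖ + J) := by
        have h₁ : 0 ≤ |c| * ((2 * Real.pi) ^ d * M ^ 2) * J := by positivity
        have h₂ : 0 ≤ |c| * (2 * M ^ 2) * ‖f x - g x‖ := by positivity
        linear_combination h₁ + h₂

theorem isMeanLipschitz_renormalizedNonlinearity (μ : ℝ) :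
    IsMeanLipschitz (renormalizedNonlinearity d μ) :=
  (isMeanLipschitz_powerNonlinearity μ 1).sub (isMeanLipschitz_integral_norm_sq_mul _)

end MeanLipschitz

/-! ### Wave packets -/

/-- Multi-indices for the `2 m + 1` factors of `|u|^{2 m} u`, `u` being a sum over `ι`. -/
def FactorIndex (ι : Type*) : ℕ → Type _
  | 0 => ι
  | m + 1 => ι × ι × FactorIndex ι m

section FactorIndex

variable {ι G H : Type*} [AddCommGroup G] [AddCommGroup H]

instance FactorIndex.fintype [Fintype ι] : ∀ m, Fintype (FactorIndex ι m)
  | 0 => inferInstanceAs (Fintype ι)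
  | m + 1 =>
    letI := FactorIndex.fintype m
    inferInstanceAs (Fintype (ι × ι × FactorIndex ι m))

theorem FactorIndex.sum_succ [Fintype ι] {M : Type*} [AddCommMonoid M] {m : ℕ}
    (f : ι → ι → FactorIndex ι m → M) :
    ∑ p : FactorIndex ι (m + 1), f p.1 p.2.1 p.2.2 = ∑ p, ∑ j, ∑ i, f i j p :=
  (Fintype.sum_prod_type_right fun p : ι × ι × FactorIndex ι m => f p.1 p.2.1 p.2.2).trans <|
    Fintype.sum_prod_type_right fun q => ∑ i, f i q.1 q.2

/-- The alternating sum `f i₁ - f i₂ + f i₃ - ⋯ + f i_{2m+1}`. -/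
def alternatingSum (f : ι → G) : ∀ m, FactorIndex ι m → G
  | 0, i => f i
  | m + 1, p => f p.1 - f p.2.1 + alternatingSum f m p.2.2

theorem map_alternatingSum (φ : G →+ H) (f : ι → G) (m : ℕ) (p : FactorIndex ι m) :
    φ (alternatingSum f m p) = alternatingSum (φ ∘ f) m p := by
  induction m with
  | zero => rfl
  | succ m ih => simp only [alternatingSum, map_add, map_sub, ih, Function.comp_apply]

end FactorIndex

/-- The oscillation `e^{-iνt}` of a wave of frequency `ν`. -/
def osc (ν t : ℝ) : ℂ := Complex.exp (Complex.I * (-ν * t : ℝ))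

theorem norm_osc (ν t : ℝ) : ‖osc ν t‖ = 1 := Complex.norm_exp_I_mul_ofReal _

theorem osc_zero_left (t : ℝ) : osc 0 t = 1 := by simp [osc]

theorem osc_zero_right (ν : ℝ) : osc ν 0 = 1 := by simp [osc]

theorem osc_sub_add (ν ν' ν'' t : ℝ) :
    osc (ν - ν' + ν'') t = osc ν t * (starRingEnd ℂ (osc ν' t) * osc ν'' t) := by
  rw [osc, osc, osc, osc, ← Complex.exp_conj, ← Complex.exp_add, ← Complex.exp_add, map_mul,
    Complex.conj_I, Complex.conj_ofReal]
  congr 1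
  push_cast
  ring

theorem continuous_osc (ν : ℝ) : Continuous (osc ν) := by
  unfold osc; fun_prop

theorem norm_integral_osc_le {ν : ℝ} (hν : ν ≠ 0) (T : ℝ) :
    ‖∫ t in (0 : ℝ)..T, osc ν t‖ ≤ 2 / |ν| := by
  set c : ℂ := Complex.I * (-ν : ℝ) with hc
  have hcn : ‖c‖ = |ν| := by
    rw [hc, norm_mul, Complex.norm_I, one_mul, Complex.norm_real, Real.norm_eq_abs, abs_neg]
  have hosc : osc ν = fun t : ℝ => Complex.exp (c * t) := funext fun t => by
    rw [osc, hc, Complex.ofReal_mul, mul_assoc]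
  have hint : ∫ t in (0 : ℝ)..T, osc ν t = (osc ν T - osc ν 0) / c := by
    rw [hosc]
    exact integral_exp_mul_complex (norm_ne_zero_iff.1 (hcn.trans_ne (abs_ne_zero.2 hν)))
  rw [hint, norm_div, hcn]
  gcongr
  refine (norm_sub_le _ _).trans ?_
  rw [norm_osc, norm_osc, one_add_one_eq_two]

section Packet

variable {d : ℕ}

/-- The weighted coefficients of the plane wave `e^{ik·x}`. -/
def planeWave (ρ : ℝ≥0) (k : Fin d → ℤ) : Coeffs d := (weight ρ k : ℂ)⁻¹ • delta k

theorem norm_planeWave (ρ : ℝ≥0) (k : Fin d → ℤ) : ‖planeWave ρ k‖ = (weight ρ k)⁻¹ := by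
  rw [planeWave, norm_smul, norm_delta, mul_one, norm_inv,
    Complex.norm_of_nonneg (weight_pos ρ k).le]

theorem planeWave_apply (ρ : ℝ≥0) (j k : Fin d → ℤ) :
    planeWave ρ j k = if k = j then (weight ρ k : ℂ)⁻¹ else 0 := by
  rw [← coord_apply, planeWave, map_smul, coord_apply, delta_apply, smul_eq_mul, mul_ite, mul_one,
    mul_zero]
  exact if_ctx_congr Iff.rfl (fun h => by rw [h]) fun _ => rfl

theorem conv_planeWave (ρ : ℝ≥0) (j k : Fin d → ℤ) :
    conv ρ (planeWave ρ j) (planeWave ρ k) = planeWave ρ (j + k) := by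
  have hw : ∀ k : Fin d → ℤ, (weight ρ k : ℂ) ≠ 0 := fun k => by
    exact_mod_cast (weight_pos ρ k).ne'
  simp only [planeWave, map_smul, _root_.smul_apply, conv_delta_delta, smul_smul]
  congr 1
  field_simp [hw]

theorem conjRefl_smul_planeWave (ρ : ℝ≥0) (c : ℂ) (k : Fin d → ℤ) :
    conjRefl (c • planeWave ρ k) = starRingEnd ℂ c • planeWave ρ (-k) := by
  ext l
  rcases eq_or_ne l (-k) with rfl | h
  · simp [planeWave_apply]
  · simp [planeWave_apply, h, neg_eq_iff_eq_neg]

theorem freeGroup_planeWave (ρ : ℝ≥0) (t : ℝ) (k : Fin d → ℤ) :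
    freeGroup t (planeWave ρ k) = osc (dispersion k) t • planeWave ρ k := by
  rw [planeWave, map_smul, freeGroup_delta, smul_comm, osc]

theorem synth_planeWave (ρ : ℝ≥0) (x : EuclideanSpace ℝ (Fin d)) (k : Fin d → ℤ) :
    synth ρ x (planeWave ρ k) = Complex.exp (Complex.I * freqForm k x) := by
  have hw : (weight ρ k : ℂ) ≠ 0 := by exact_mod_cast (weight_pos ρ k).ne'
  rw [planeWave, map_smul, synth_delta, smul_eq_mul, mul_comm, mul_assoc, mul_inv_cancel₀ hw,
    mul_one]

variable {ι : Type*} [Fintype ι] (κ : ι → Fin d → ℤ)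

/-- The free solution at time `t` whose initial data is `A` times the sum of the plane waves with
frequencies `κ i`. -/
def packet (ρ : ℝ≥0) (A t : ℝ) : Coeffs d :=
  (A : ℂ) • ∑ i, osc (dispersion (κ i)) t • planeWave ρ (κ i)

theorem packet_zero_right (ρ : ℝ≥0) (A : ℝ) :
    packet κ ρ A 0 = (A : ℂ) • ∑ i, planeWave ρ (κ i) := by
  simp only [packet, osc_zero_right, one_smul]

theorem freeGroup_packet (ρ : ℝ≥0) (A t : ℝ) :
    freeGroup t (packet κ ρ A 0) = packet κ ρ A t := by
  rw [packet_zero_right, map_smul, map_sum, packet]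
  simp only [freeGroup_planeWave]

theorem powConv_packet (ρ : ℝ≥0) (A t : ℝ) (m : ℕ) :
    powConv ρ m (packet κ ρ A t) = (A : ℂ) ^ (2 * m + 1) • ∑ p : FactorIndex ι m,
      osc (alternatingSum (dispersion ∘ κ) m p) t • planeWave ρ (alternatingSum κ m p) := by
  induction m with
  | zero => simp only [powConv, mul_zero, zero_add, pow_one]; rfl
  | succ m ih =>
    have hconj : conjRefl (packet κ ρ A t) =
        ∑ i, ((A : ℂ) * starRingEnd ℂ (osc (dispersion (κ i)) t)) • planeWave ρ (-κ i) := by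
      simp only [packet, Finset.smul_sum, smul_smul, map_sum, conjRefl_smul_planeWave, map_mul,
        Complex.conj_ofReal]
    rw [powConv, hconj, ih, packet]
    simp only [alternatingSum]
    rw [FactorIndex.sum_succ fun i j p =>
      osc ((dispersion ∘ κ) i - (dispersion ∘ κ) j + alternatingSum (dispersion ∘ κ) m p) t •
        planeWave ρ (κ i - κ j + alternatingSum κ m p)]
    simp only [map_smul, map_sum, _root_.smul_apply, _root_.sum_apply, conv_planeWave,
      Finset.smul_sum, smul_smul]
    refine Finset.sum_congr rfl fun p _ => Finset.sum_congr rfl fun j _ =>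
      Finset.sum_congr rfl fun i _ => ?_
    rw [osc_sub_add, sub_eq_add_neg, add_assoc, Function.comp_apply, Function.comp_apply]
    congr 1
    ring

theorem packet_apply_zero (hκ : ∀ i, κ i ≠ 0) (ρ : ℝ≥0) (A t : ℝ) : packet κ ρ A t 0 = 0 := by
  rw [← coord_apply, packet, map_smul, map_sum]
  refine smul_eq_zero_of_right _ (Finset.sum_eq_zero fun i _ => ?_)
  rw [map_smul, coord_apply, planeWave_apply, if_neg (hκ i).symm, smul_zero]

theorem norm_packet_zero_le (ρ : ℝ≥0) {A : ℝ} (hA : 0 ≤ A) :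
    ‖packet κ ρ A 0‖ ≤ A * ∑ i, (weight ρ (κ i))⁻¹ := by
  rw [packet_zero_right, norm_smul, Complex.norm_real, Real.norm_of_nonneg hA]
  gcongr
  exact norm_sum_le_of_le _ fun i _ => (norm_planeWave ρ (κ i)).le

/-- The sum of the oscillations `e^{-iνt}` of the interactions `κ i₁ - κ i₂ + ⋯ + κ i_{2m+1} = 0`
of the frequencies `κ` in `|u|^{2m} u` that feed the zero mode. -/
def zeroModeSource (m : ℕ) (t : ℝ) : ℂ :=
  ∑ p : FactorIndex ι m,
    if alternatingSum κ m p = 0 then osc (alternatingSum (dispersion ∘ κ) m p) t else 0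

theorem powConv_packet_apply_zero (ρ : ℝ≥0) (A t : ℝ) (m : ℕ) :
    powConv ρ m (packet κ ρ A t) 0 = (A : ℂ) ^ (2 * m + 1) * zeroModeSource κ m t := by
  rw [← coord_apply, powConv_packet, map_smul, map_sum, smul_eq_mul, zeroModeSource]
  simp [planeWave_apply, weight_zero, eq_comm]

theorem dispersion_nsmul (N : ℕ) (k : Fin d → ℤ) : dispersion (N • k) = N ^ 2 * dispersion k := by
  simp only [dispersion, Pi.smul_apply, nsmul_eq_mul, Int.cast_mul, Int.cast_natCast, mul_pow,
    ← Finset.mul_sum, mul_div_assoc]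

theorem zeroModeSource_nsmul {N : ℕ} (hN : N ≠ 0) (m : ℕ) (t : ℝ) :
    zeroModeSource (N • κ) m t = zeroModeSource κ m (N ^ 2 * t) := by
  refine Finset.sum_congr rfl fun p _ => ?_
  have hfreq : alternatingSum (N • κ) m p = N • alternatingSum κ m p :=
    (map_alternatingSum (nsmulAddMonoidHom (α := Fin d → ℤ) N) κ m p).symm
  have hdisp : alternatingSum (dispersion ∘ (N • κ)) m p =
      N ^ 2 * alternatingSum (dispersion ∘ κ) m p := by
    rw [← AddMonoidHom.coe_mulLeft, map_alternatingSum]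
    exact congrArg (alternatingSum · m p) (funext fun i => dispersion_nsmul N (κ i))
  have hosc : ∀ ν : ℝ, osc (N ^ 2 * ν) t = osc ν (N ^ 2 * t) := fun ν => by
    rw [osc, osc, neg_mul, neg_mul, mul_comm _ ν, mul_assoc]
  rw [hfreq, hdisp, hosc]
  exact if_congr (smul_eq_zero_iff_right hN) rfl rfl

theorem integral_zeroModeSource_nsmul {N : ℕ} (hN : N ≠ 0) (m : ℕ) (T : ℝ) :
    ∫ t in (0 : ℝ)..T, zeroModeSource (N • κ) m t =
      ((N : ℝ) ^ 2)⁻¹ • ∫ t in (0 : ℝ)..N ^ 2 * T, zeroModeSource κ m t := by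
  simp only [zeroModeSource_nsmul κ hN]
  rw [intervalIntegral.integral_comp_mul_left _ (by positivity), mul_zero]

end Packet

/-! ### Initial data -/

section PacketData

variable {d : ℕ}

theorem weight_inv_nsmul {N : ℕ} (hN : N ≠ 0) (k : Fin d → ℤ) :
    weight (N : ℝ≥0)⁻¹ (N • k) = weight 1 k := by
  have habs : absSum (N • k) = N * absSum k := by simp [absSum, abs_mul, Finset.mul_sum]
  have hN' : (N : ℝ) ≠ 0 := Nat.cast_ne_zero.2 hN
  rw [weight, weight, habs]
  push_cast
  congr 1
  field_simp

theorem le_japaneseBracket_nsmul (N : ℕ) {k : Fin d → ℤ} (hk : k ≠ 0) :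
    (N : ℝ) ≤ japaneseBracket (N • k) := by
  obtain ⟨i, hi⟩ := Function.ne_iff.1 hk
  have hki : (1 : ℝ) ≤ (k i : ℝ) ^ 2 := by
    exact_mod_cast (sq_pos_of_ne_zero hi : 0 < k i ^ 2)
  refine Real.le_sqrt_of_sq_le ?_
  calc (N : ℝ) ^ 2 ≤ N ^ 2 * (k i : ℝ) ^ 2 := le_mul_of_one_le_right (sq_nonneg _) hki
    _ = (((N • k) i : ℤ) : ℝ) ^ 2 := by simp [mul_pow]
    _ ≤ ∑ i, (((N • k) i : ℤ) : ℝ) ^ 2 :=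
        Finset.single_le_sum (f := fun i => (((N • k) i : ℤ) : ℝ) ^ 2)
          (fun _ _ => sq_nonneg _) (Finset.mem_univ i)
    _ ≤ 1 + ∑ i, (((N • k) i : ℤ) : ℝ) ^ 2 := le_add_of_nonneg_left zero_le_one

theorem enorm_fourierCoeff_zero_le_flNorm (r : ℝ) {p : ℝ≥0∞} (hp : 1 ≤ p)
    (f : EuclideanSpace ℝ (Fin d) → ℂ) : ‖fourierCoeff f 0‖ₑ ≤ flNorm r p f := by
  have hbracket : japaneseBracket (0 : Fin d → ℤ) = 1 := by simp [japaneseBracket]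
  have h := enorm_le_eLpNorm_count
    (fun k : Fin d → ℤ => ((japaneseBracket k ^ r : ℝ) : ℂ) * fourierCoeff f k) 0
    (one_pos.trans_le hp).ne'
  rwa [hbracket, Real.one_rpow, Complex.ofReal_one, one_mul] at h

variable {ι : Type*} [Fintype ι] (κ : ι → Fin d → ℤ)

/-- `A` times the sum of the plane waves with frequencies `κ i`. -/
def packetData (A : ℝ) (x : EuclideanSpace ℝ (Fin d)) : ℂ :=
  ∑ i, (A : ℂ) * Complex.exp (Complex.I * freqForm (κ i) x)

theorem synth_packet_zero (ρ : ℝ≥0) (A : ℝ) :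
    (fun x => synth ρ x (packet κ ρ A 0)) = packetData κ A := by
  funext x
  simp only [packet_zero_right, packetData, map_smul, map_sum, synth_planeWave, smul_eq_mul,
    Finset.mul_sum]

theorem contDiff_packetData (A : ℝ) : ContDiff ℝ ∞ (packetData κ A) := by
  rw [← synth_packet_zero κ 1]
  exact contDiff_synth_apply one_pos _

theorem isPeriodic_packetData (A : ℝ) : IsPeriodic (packetData κ A) := by
  rw [← synth_packet_zero κ 1]
  exact isPeriodic_synth 1 _

theorem fourierCoeff_packetData (A : ℝ) :
    fourierCoeff (packetData κ A) = ∑ i, Set.indicator {κ i} fun _ => (A : ℂ) := by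
  funext k
  have hw : (weight 1 k : ℂ) ≠ 0 := by exact_mod_cast (weight_pos 1 k).ne'
  rw [← synth_packet_zero κ 1, fourierCoeff_synth one_pos, ← coord_apply, packet_zero_right,
    map_smul, map_sum, smul_eq_mul, Finset.mul_sum, Finset.mul_sum, Finset.sum_apply]
  refine Finset.sum_congr rfl fun i _ => ?_
  rw [coord_apply, planeWave_apply, Set.indicator_apply]
  simp only [Set.mem_singleton_iff]
  split_ifs
  · rw [mul_left_comm, mul_inv_cancel₀ hw, mul_one]
  · rw [mul_zero, mul_zero]

theorem flNorm_packetData_le (s : ℝ) {p : ℝ≥0∞} (hp : 1 ≤ p) (A : ℝ) :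
    flNorm s p (packetData κ A) ≤ ∑ i, ‖japaneseBracket (κ i) ^ s * A‖ₑ := by
  have hsum : (fun k => ((japaneseBracket k ^ s : ℝ) : ℂ) * fourierCoeff (packetData κ A) k) =
      ∑ i, Set.indicator {κ i} fun _ => ((japaneseBracket (κ i) ^ s * A : ℝ) : ℂ) := by
    funext k
    rw [fourierCoeff_packetData, Finset.sum_apply, Finset.sum_apply, Finset.mul_sum]
    refine Finset.sum_congr rfl fun i _ => ?_
    by_cases h : k = κ i
    · simp [h]
    · simp [h]
  rw [flNorm, hsum]
  refine (eLpNorm_sum_le (fun i _ => (measurable_of_countable _).aestronglyMeasurable) hp).trans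
    (Finset.sum_le_sum fun i _ => (eLpNorm_indicator_const_le _ p).trans_eq ?_)
  rw [Measure.count_singleton, ENNReal.one_rpow, mul_one, ← ofReal_norm, Complex.norm_real,
    ofReal_norm]

theorem flNorm_packetData_nsmul_le (hκ : ∀ i, κ i ≠ 0) {s : ℝ} (hs : s ≤ 0) {p : ℝ≥0∞}
    (hp : 1 ≤ p) {A : ℝ} (hA : 0 ≤ A) {N : ℕ} (hN : N ≠ 0) :
    flNorm s p (packetData (N • κ) A) ≤ ENNReal.ofReal (Fintype.card ι * (A * (N : ℝ) ^ s)) := by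
  refine (flNorm_packetData_le (N • κ) s hp A).trans ?_
  calc ∑ i, ‖japaneseBracket (N • κ i) ^ s * A‖ₑ ≤ ∑ _i : ι, ENNReal.ofReal (A * (N : ℝ) ^ s) := by
        refine Finset.sum_le_sum fun i _ => ?_
        have hN' : (0 : ℝ) < N := by positivity
        have hbracket := le_japaneseBracket_nsmul N (hκ i)
        rw [Real.enorm_of_nonneg
          (mul_nonneg (Real.rpow_nonneg (hN'.le.trans hbracket) s) hA), mul_comm]
        exact ENNReal.ofReal_le_ofReal
          (mul_le_mul_of_nonneg_left (Real.rpow_le_rpow_of_nonpos hN' hbracket hs) hA)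
    _ = ENNReal.ofReal (Fintype.card ι * (A * (N : ℝ) ^ s)) := by
        rw [Finset.sum_const, Finset.card_univ, nsmul_eq_mul,
          ENNReal.ofReal_mul (Nat.cast_nonneg (Fintype.card ι)), ENNReal.ofReal_natCast]

end PacketData

/-! ### The first Picard iterate of a wave packet -/

section FirstIterate

variable {d σ : ℕ} {μ : ℝ} {F : (EuclideanSpace ℝ (Fin d) → ℂ) → EuclideanSpace ℝ (Fin d) → ℂ}

namespace SpectralNonlinearity

theorem norm_profile_sub_firstIterate_le (S : SpectralNonlinearity d σ μ F) {ρ : ℝ≥0} {R T : ℝ}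
    (hT : 0 ≤ T) {v : ℝ → Coeffs d} (hvR : ∀ t ∈ Set.Icc 0 T, ‖v t‖ ≤ R)
    (hv : ∀ t ∈ Set.Icc 0 T, HasDerivWithinAt v (S.field ρ t (v t)) (Set.Icc 0 T) t) :
    ‖v T - v 0 - ∫ t in (0 : ℝ)..T, S.field ρ t (v 0)‖ ≤
      (S.const * R ^ (2 * σ)) ^ 2 * R * T ^ 2 := by
  have hv0 := hvR 0 (Set.left_mem_Icc.2 hT)
  have hR : 0 ≤ R := (norm_nonneg _).trans hv0
  set K := S.const * R ^ (2 * σ)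
  have hK : 0 ≤ K := mul_nonneg S.const_nonneg (pow_nonneg hR _)
  have hmove : ∀ t ∈ Set.Icc 0 T, ‖v t - v 0‖ ≤ K * R * T := fun t ht =>
    (norm_image_sub_le_of_norm_deriv_le_segment' hv
      (fun t ht => S.norm_field_le ρ t (hvR t (Set.Ico_subset_Icc_self ht))) t ht).trans <| by
        rw [sub_zero]
        exact mul_le_mul_of_nonneg_left ht.2 (mul_nonneg hK hR)
  have hder : ∀ t ∈ Set.Icc 0 T, HasDerivWithinAt
      (fun t => v t - ∫ τ in (0 : ℝ)..t, S.field ρ τ (v 0))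
      (S.field ρ t (v t) - S.field ρ t (v 0)) (Set.Icc 0 T) t := fun t ht =>
    (hv t ht).sub
      ((S.continuous_field ρ (v 0)).integral_hasStrictDerivAt 0 t).hasDerivAt.hasDerivWithinAt
  have hmain := norm_image_sub_le_of_norm_deriv_le_segment' (C := K * (K * R * T)) hder
    (fun t ht => ?_) T (Set.right_mem_Icc.2 hT)
  · rw [intervalIntegral.integral_same, sub_zero, sub_right_comm] at hmain
    exact hmain.trans_eq (by ring)
  · have ht' := Set.Ico_subset_Icc_self ht
    exact (S.norm_field_sub_le ρ t (hvR t ht') hv0).trans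
      (mul_le_mul_of_nonneg_left (hmove t ht') hK)

variable {ι : Type*} [Fintype ι] {κ : ι → Fin d → ℤ} (S : SpectralNonlinearity d σ μ F)

theorem field_packet_apply_zero (hκ : ∀ i, κ i ≠ 0) (ρ : ℝ≥0) (A t : ℝ) :
    S.field ρ t (packet κ ρ A 0) 0 =
      -Complex.I * μ * A ^ (2 * σ + 1) * zeroModeSource κ σ t := by
  rw [← coord_apply, field, map_smul, coord_apply, freeGroup_apply, freeGroup_packet,
    S.zero_mode ρ (packet_apply_zero κ hκ ρ A t), powConv_packet_apply_zero, dispersion_zero]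
  simp [mul_assoc]

theorem norm_integral_field_packet_apply_zero (hκ : ∀ i, κ i ≠ 0) (ρ : ℝ≥0) {A : ℝ} (hA : 0 ≤ A)
    (T : ℝ) : ‖(∫ t in (0 : ℝ)..T, S.field ρ t (packet κ ρ A 0)) 0‖ =
      |μ| * A ^ (2 * σ + 1) * ‖∫ t in (0 : ℝ)..T, zeroModeSource κ σ t‖ := by
  have hcomm := (coord (0 : Fin d → ℤ)).intervalIntegral_comp_comm
    ((S.continuous_field ρ (packet κ ρ A 0)).intervalIntegrable (μ := volume) 0 T)
  simp only [coord_apply, S.field_packet_apply_zero hκ, intervalIntegral.integral_const_mul]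
    at hcomm
  rw [← hcomm]
  simp only [norm_mul, norm_neg, Complex.norm_I, one_mul, Complex.norm_real, norm_pow,
    Real.norm_eq_abs, abs_of_nonneg hA]

theorem sub_le_norm_profile_apply_zero (hκ : ∀ i, κ i ≠ 0) {ρ : ℝ≥0} {A R T : ℝ} (hA : 0 ≤ A)
    (hT : 0 ≤ T) {v : ℝ → Coeffs d} (hv0 : v 0 = packet κ ρ A 0)
    (hvR : ∀ t ∈ Set.Icc 0 T, ‖v t‖ ≤ R)
    (hv : ∀ t ∈ Set.Icc 0 T, HasDerivWithinAt v (S.field ρ t (v t)) (Set.Icc 0 T) t) :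
    |μ| * A ^ (2 * σ + 1) * ‖∫ t in (0 : ℝ)..T, zeroModeSource κ σ t‖ -
      (S.const * R ^ (2 * σ)) ^ 2 * R * T ^ 2 ≤ ‖v T 0‖ := by
  rw [← S.norm_integral_field_packet_apply_zero hκ ρ hA, sub_le_comm, ← hv0]
  refine ((norm_sub_norm_le _ _).trans_eq (norm_sub_rev _ _)).trans (le_trans (le_of_eq ?_)
    ((norm_apply_le _ 0).trans (S.norm_profile_sub_firstIterate_le hT hvR hv)))
  have h0 : v 0 0 = 0 := by rw [hv0, packet_apply_zero κ hκ]
  rw [← coord_apply 0 (v T - _ - _), map_sub, map_sub, coord_apply, coord_apply, coord_apply, h0,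
    sub_zero]

theorem exists_solution_packetData (hκ : ∀ i, κ i ≠ 0) {ρ : ℝ≥0} (hρ : 0 < ρ) {A : ℝ}
    (hA : 0 ≤ A) {R T : ℝ≥0} (hR : ‖packet κ ρ A 0‖ ≤ R) (hT : 0 < T)
    (hsmall : S.const * (2 * R) ^ (2 * σ) * T * 2 ≤ 1) :
    ∃ ψ : ℝ → EuclideanSpace ℝ (Fin d) → ℂ, IsSmoothSolution F T ψ ∧ ψ 0 = packetData κ A ∧
      |μ| * A ^ (2 * σ + 1) * ‖∫ t in (0 : ℝ)..T, zeroModeSource κ σ t‖ -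
        (S.const * (2 * R) ^ (2 * σ)) ^ 2 * (2 * R) * T ^ 2 ≤ ‖fourierCoeff (ψ T) 0‖ := by
  obtain ⟨v, hv0, hv⟩ := S.exists_profile ρ hR hsmall
  refine ⟨fun t x => wave ρ (t, x) (v t),
    S.isSmoothSolution_wave_profile (NNReal.coe_pos.2 hT) hρ fun t ht => (hv t ht).2, ?_, ?_⟩
  · rw [← synth_packet_zero κ ρ, ← hv0]
    rfl
  · have hzero : fourierCoeff (fun x => wave ρ (T, x) (v T)) 0 = v T 0 := by
      simp only [← synth_freeGroup]
      rw [fourierCoeff_synth hρ, weight_zero, freeGroup_apply, dispersion_zero]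
      simp
    rw [hzero]
    exact S.sub_le_norm_profile_apply_zero hκ hA T.2 hv0 (fun t ht => (hv t ht).1)
      fun t ht => (hv t ht).2

theorem exists_solution_packetData_nsmul (S : SpectralNonlinearity d σ μ F)
    (hκ : ∀ i, κ i ≠ 0) :
    ∃ L M : ℝ, 0 ≤ L ∧ 0 ≤ M ∧ ∀ (A : ℝ) (N : ℕ) (T : ℝ), 0 ≤ A → N ≠ 0 → 0 < T →
      L * (T * A ^ (2 * σ)) * 2 ≤ 1 →
      N ^ 2 * T / 2 ≤ ‖∫ t in (0 : ℝ)..N ^ 2 * T, zeroModeSource κ σ t‖ →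
      ∃ ψ : ℝ → EuclideanSpace ℝ (Fin d) → ℂ, IsSmoothSolution F T ψ ∧
        ψ 0 = packetData (N • κ) A ∧
        |μ| * A ^ (2 * σ + 1) * (T / 2) - M * A * (T * A ^ (2 * σ)) ^ 2 ≤
          ‖fourierCoeff (ψ T) 0‖ := by
  set B : ℝ := ∑ i, (weight 1 (κ i))⁻¹ with hB
  have hB0 : 0 ≤ B := Finset.sum_nonneg fun _ _ => inv_nonneg.2 (weight_pos _ _).le
  set L : ℝ := S.const * (2 * B) ^ (2 * σ) with hL
  have hL0 : 0 ≤ L := mul_nonneg S.const_nonneg (by positivity)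
  refine ⟨L, L ^ 2 * (2 * B), hL0, by positivity, fun A N T hA hN hT hsmall hsource => ?_⟩
  obtain ⟨R, hRB⟩ : ∃ R : ℝ≥0, (R : ℝ) = A * B := CanLift.prf _ (mul_nonneg hA hB0)
  have hK : S.const * (2 * R) ^ (2 * σ) = L * A ^ (2 * σ) := by
    rw [hRB, hL, mul_left_comm 2 A B, mul_pow A, mul_left_comm, mul_comm]
  have hR : ‖packet (N • κ) (N : ℝ≥0)⁻¹ A 0‖ ≤ R := by
    refine (norm_packet_zero_le (N • κ) _ hA).trans_eq ?_
    rw [hRB, hB]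
    exact congrArg (A * ·) (Finset.sum_congr rfl fun i _ => by
      rw [Pi.smul_apply, weight_inv_nsmul hN])
  lift T to ℝ≥0 using hT.le
  obtain ⟨ψ, hψ, hψ0, hψT⟩ := S.exists_solution_packetData (κ := N • κ) (T := T)
    (fun i => smul_ne_zero hN (hκ i)) (inv_pos.2 (by positivity)) hA hR hT (by
      rwa [hK, mul_assoc L, mul_comm _ (T : ℝ)])
  refine ⟨ψ, hψ, hψ0, le_trans (sub_le_sub ?_ ?_) hψT⟩
  · rw [integral_zeroModeSource_nsmul κ hN, norm_smul, Real.norm_of_nonneg (by positivity),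
      inv_mul_eq_div]
    refine mul_le_mul_of_nonneg_left ((le_div_iff₀ (by positivity)).2 ?_) (by positivity)
    linarith
  · rw [hK, hRB]
    exact le_of_eq (by ring)

theorem exists_solution_packetData_nsmul_of_small (S : SpectralNonlinearity d σ μ F) (hμ : μ ≠ 0)
    (hκ : ∀ i, κ i ≠ 0) :
    ∃ c > 0, ∀ (A : ℝ) (N : ℕ) (T : ℝ), 0 ≤ A → N ≠ 0 → 0 < T → T * A ^ (2 * σ) ≤ c →
      N ^ 2 * T / 2 ≤ ‖∫ t in (0 : ℝ)..N ^ 2 * T, zeroModeSource κ σ t‖ →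
      ∃ ψ : ℝ → EuclideanSpace ℝ (Fin d) → ℂ, IsSmoothSolution F T ψ ∧
        ψ 0 = packetData (N • κ) A ∧ c * (T * A ^ (2 * σ + 1)) ≤ ‖fourierCoeff (ψ T) 0‖ := by
  obtain ⟨L, M, hL, hM, hsol⟩ := S.exists_solution_packetData_nsmul hκ
  obtain ⟨c, hc, hcmin⟩ := exists_pos_mul_lt (lt_min one_half_pos (half_pos (abs_pos.2 hμ)))
    (L + (M + 1))
  obtain ⟨hcL, hcμ⟩ := lt_min_iff.1 hcmin
  have hLc : 0 ≤ L * c := mul_nonneg hL hc.le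
  have hMc : 0 ≤ M * c := mul_nonneg hM hc.le
  refine ⟨c, hc, fun A N T hA hN hT hsmall hsource => ?_⟩
  obtain ⟨ψ, hψ, hψ0, hψT⟩ := hsol A N T hA hN hT
    (by linarith [mul_le_mul_of_nonneg_left hsmall hL]) hsource
  refine ⟨ψ, hψ, hψ0, le_trans ?_ hψT⟩
  calc c * (T * A ^ (2 * σ + 1))
      ≤ (|μ| / 2 - M * c) * (T * A ^ (2 * σ + 1)) := by
        gcongr
        linarith
    _ ≤ (|μ| / 2 - M * (T * A ^ (2 * σ))) * (T * A ^ (2 * σ + 1)) := by gcongr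
    _ = |μ| * A ^ (2 * σ + 1) * (T / 2) - M * A * (T * A ^ (2 * σ)) ^ 2 := by ring

end SpectralNonlinearity

end FirstIterate

section Inflation

open Filter

variable {d σ : ℕ} {μ : ℝ} {F : (EuclideanSpace ℝ (Fin d) → ℂ) → EuclideanSpace ℝ (Fin d) → ℂ}
variable {ι : Type*} [Fintype ι] {κ : ι → Fin d → ℤ}

theorem SpectralNonlinearity.hasNormInflation_of_packets (S : SpectralNonlinearity d σ μ F)
    (hF : IsMeanLipschitz F) (hμ : μ ≠ 0) (hκ : ∀ i, κ i ≠ 0) {s : ℝ} (hs : s ≤ 0)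
    (H : ∀ ε : ℝ, 0 < ε → ∃ (A : ℝ) (N : ℕ) (T : ℝ), 0 ≤ A ∧ N ≠ 0 ∧ 0 < T ∧ T ≤ ε ∧
      T * A ^ (2 * σ) ≤ ε ∧ A * (N : ℝ) ^ s ≤ ε ∧ 1 / ε ≤ T * A ^ (2 * σ + 1) ∧
      N ^ 2 * T / 2 ≤ ‖∫ t in (0 : ℝ)..N ^ 2 * T, zeroModeSource κ σ t‖) :
    HasNormInflation F s := by
  obtain ⟨c, hc, hsol⟩ := S.exists_solution_packetData_nsmul_of_small hμ hκ
  set ε : ℕ → ℝ := fun n => min c (1 / ((n : ℝ) + 1))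
  have hε : ∀ n, 0 < ε n := fun n => lt_min hc Nat.one_div_pos_of_nat
  have hε_lim : Tendsto ε atTop (nhds 0) :=
    squeeze_zero (fun n => (hε n).le) (fun n => min_le_right _ _)
      tendsto_one_div_add_atTop_nhds_zero_nat
  have hε_inv : ∀ n : ℕ, (n : ℝ) ≤ 1 / ε n := fun n => by
    rw [le_div_iff₀ (hε n)]
    refine (mul_le_mul_of_nonneg_left (min_le_right _ _) n.cast_nonneg).trans ?_
    rw [mul_one_div]
    exact div_le_one_of_le₀ (by linarith) (by positivity)
  choose A N T hA hN hT hTε hsmall hdata hlarge hsource using fun n => H (ε n) (hε n)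
  choose ψ hψ hψ0 hψT using fun n =>
    hsol (A n) (N n) (T n) (hA n) (hN n) (hT n) ((hsmall n).trans (min_le_left _ _)) (hsource n)
  refine ⟨fun n => packetData (N n • κ) (A n), T, ψ,
    fun n => ⟨contDiff_packetData _ _, isPeriodic_packetData _ _⟩, fun p hp => ?_, hT,
    squeeze_zero (fun n => (hT n).le) hTε hε_lim, fun n => ⟨hψ n, hψ0 n⟩,
    fun n χ hχ hχ0 τ hτ => hχ.unique hF (hT n) (hψ n) (hχ0.trans (hψ0 n).symm) hτ,
    fun r p hp => ?_⟩
  · have hbound : Tendsto (fun n => ENNReal.ofReal (Fintype.card ι * ε n)) atTop (nhds 0) := by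
      simpa using ENNReal.tendsto_ofReal (hε_lim.const_mul (Fintype.card ι : ℝ))
    refine tendsto_of_tendsto_of_tendsto_of_le_of_le tendsto_const_nhds hbound
      (fun n => zero_le) fun n => (flNorm_packetData_nsmul_le κ hκ hs hp (hA n) (hN n)).trans ?_
    exact ENNReal.ofReal_le_ofReal (mul_le_mul_of_nonneg_left (hdata n) (Nat.cast_nonneg _))
  · have hbound : Tendsto (fun n : ℕ => ENNReal.ofReal (c * n)) atTop (nhds ∞) :=
      ENNReal.tendsto_ofReal_atTop.comp (tendsto_natCast_atTop_atTop.const_mul_atTop hc)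
    refine tendsto_nhds_top_mono hbound (Eventually.of_forall fun n => ?_)
    refine le_trans ?_ (enorm_fourierCoeff_zero_le_flNorm r hp _)
    rw [← ofReal_norm]
    exact ENNReal.ofReal_le_ofReal ((mul_le_mul_of_nonneg_left
      ((hε_inv n).trans (hlarge n)) hc.le).trans (hψT n))

end Inflation

/-! ### Resonant frequencies -/

section Resonance

open Filter

variable {d : ℕ} {ι : Type*} {κ : ι → Fin d → ℤ} {m : ℕ}

/-- Among the frequencies `κ` there is a resonant interaction of `2 m + 1` waves feeding the zero
mode: both the alternating sum of the frequencies and that of their dispersions vanish. -/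
def IsResonant (κ : ι → Fin d → ℤ) (m : ℕ) : Prop :=
  ∃ p : FactorIndex ι m, alternatingSum κ m p = 0 ∧ alternatingSum (dispersion ∘ κ) m p = 0

theorem IsResonant.succ [Nonempty ι] : IsResonant κ m → IsResonant κ (m + 1)
  | ⟨p, hfreq, hdisp⟩ => by
    obtain ⟨i⟩ := ‹Nonempty ι›
    exact ⟨(i, i, p), by simp [alternatingSum, hfreq], by simp [alternatingSum, hdisp]⟩

theorem IsResonant.mono [Nonempty ι] {n : ℕ} (h : IsResonant κ m) (hmn : m ≤ n) :
    IsResonant κ n :=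
  Nat.le_induction h (fun _ _ => IsResonant.succ) n hmn

theorem dispersion_add_of_dotProduct_eq_zero {a b : Fin d → ℤ} (h : a ⬝ᵥ b = 0) :
    dispersion (a + b) = dispersion a + dispersion b := by
  have hab : ∑ i, (a i : ℝ) * b i = 0 := by exact_mod_cast h
  have hsq : ∑ i, ((a + b) i : ℝ) ^ 2 =
      ∑ i, (a i : ℝ) ^ 2 + ∑ i, (b i : ℝ) ^ 2 + 2 * ∑ i, (a i : ℝ) * b i := by
    rw [Finset.mul_sum, ← Finset.sum_add_distrib, ← Finset.sum_add_distrib]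
    exact Finset.sum_congr rfl fun i _ => by push_cast [Pi.add_apply]; ring
  rw [dispersion, dispersion, dispersion, hsq, hab]
  ring

theorem isResonant_rectangle {a b : Fin d → ℤ} (h : a ⬝ᵥ b = 0) :
    IsResonant ![a, a + b, b] 1 := by
  refine ⟨((0 : Fin 3), (1 : Fin 3), (2 : Fin 3)), ?_, ?_⟩
  · change a - (a + b) + b = 0
    abel
  · change dispersion a - dispersion (a + b) + dispersion b = 0
    rw [dispersion_add_of_dotProduct_eq_zero h]
    ring

theorem exists_isResonant_one (d : ℕ) :
    ∃ κ : Fin 3 → Fin (d + 2) → ℤ, (∀ i, κ i ≠ 0) ∧ IsResonant κ 1 := by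
  refine ⟨_, fun i => ?_, isResonant_rectangle (a := Pi.single 0 1) (b := Pi.single 1 1) (by simp)⟩
  fin_cases i
  · exact fun h => by simpa using congrFun h 0
  · exact fun h => by simpa using congrFun h 0
  · exact fun h => by simpa using congrFun h 1

theorem exists_isResonant_two :
    ∃ κ : Fin 3 → Fin 1 → ℤ, (∀ i, κ i ≠ 0) ∧ IsResonant κ 2 := by
  refine ⟨![1, 3, 4], fun i => ?_,
    ((0 : Fin 3), (1 : Fin 3), (0 : Fin 3), (1 : Fin 3), (2 : Fin 3)), ?_, ?_⟩
  · fin_cases i <;> exact fun h => by simpa using congrFun h 0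
  · change (1 : Fin 1 → ℤ) - 3 + (1 - 3 + 4) = 0
    norm_num
  · change dispersion (1 : Fin 1 → ℤ) - dispersion 3 + (dispersion 1 - dispersion 3 + dispersion 4)
      = 0
    norm_num [dispersion]

theorem exists_isResonant {d σ : ℕ} (h : 2 ≤ d * σ) :
    ∃ κ : Fin 3 → Fin d → ℤ, (∀ i, κ i ≠ 0) ∧ IsResonant κ σ := by
  match d with
  | 0 => simp at h
  | 1 =>
    obtain ⟨κ, hκ, hres⟩ := exists_isResonant_two
    exact ⟨κ, hκ, hres.mono (by simpa using h)⟩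
  | d + 2 =>
    obtain ⟨κ, hκ, hres⟩ := exists_isResonant_one d
    exact ⟨κ, hκ, hres.mono (Nat.pos_of_mul_pos_left (two_pos.trans_le h))⟩

theorem neg_le_re_integral_osc (ν : ℝ) {T : ℝ} (hT : 0 ≤ T) :
    -(2 / |ν|) ≤ (∫ t in (0 : ℝ)..T, osc ν t).re := by
  rcases eq_or_ne ν 0 with rfl | hν
  · simpa [osc_zero_left] using hT
  · exact (neg_le_neg (norm_integral_osc_le hν T)).trans
      (neg_le_of_abs_le (Complex.abs_re_le_norm _))

theorem integral_zeroModeSource [Fintype ι] (κ : ι → Fin d → ℤ) (m : ℕ) (T : ℝ) :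
    ∫ t in (0 : ℝ)..T, zeroModeSource κ m t = ∑ p : FactorIndex ι m,
      if alternatingSum κ m p = 0 then
        ∫ t in (0 : ℝ)..T, osc (alternatingSum (dispersion ∘ κ) m p) t else 0 := by
  simp only [zeroModeSource]
  rw [intervalIntegral.integral_finsetSum fun p _ => ?_]
  · refine Finset.sum_congr rfl fun p _ => ?_
    split_ifs
    · rfl
    · exact intervalIntegral.integral_zero
  · split_ifs
    · exact (continuous_osc _).intervalIntegrable _ _
    · exact intervalIntegrable_const

theorem IsResonant.eventually_le_norm_integral_zeroModeSource [Fintype ι] (h : IsResonant κ m) :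
    ∀ᶠ T : ℝ in atTop, T / 2 ≤ ‖∫ t in (0 : ℝ)..T, zeroModeSource κ m t‖ := by
  classical
  obtain ⟨q, hfreq, hdisp⟩ := h
  set C : FactorIndex ι m → ℝ := fun p => 2 / |alternatingSum (dispersion ∘ κ) m p|
  have hC : ∀ p, 0 ≤ C p := fun p => by positivity
  filter_upwards [eventually_ge_atTop (2 * ∑ p, C p), eventually_ge_atTop 0] with T hTC hT
  set f : FactorIndex ι m → ℝ := fun p => (if alternatingSum κ m p = 0 then
    ∫ t in (0 : ℝ)..T, osc (alternatingSum (dispersion ∘ κ) m p) t else 0).re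
  have hf : ∀ p, 0 ≤ f p + C p := fun p => by
    by_cases hp : alternatingSum κ m p = 0
    · simpa only [f, hp, if_true] using neg_le_iff_add_nonneg.1 (neg_le_re_integral_osc _ hT)
    · simpa only [f, hp, if_false, Complex.zero_re, zero_add] using hC p
  have hq : f q = T := by simp [f, hfreq, hdisp, osc_zero_left]
  have hsum : T ≤ ∑ p, f p + ∑ p, C p := by
    rw [← Finset.sum_add_distrib]
    exact (hq.ge.trans (le_add_of_nonneg_right (hC q))).trans
      (Finset.single_le_sum (f := fun p => f p + C p) (fun p _ => hf p) (Finset.mem_univ q))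
  calc T / 2 ≤ ∑ p, f p := by linarith
    _ = (∫ t in (0 : ℝ)..T, zeroModeSource κ m t).re := by
        rw [integral_zeroModeSource, Complex.re_sum]
    _ ≤ _ := Complex.re_le_norm _

theorem tendsto_natCast_rpow_nhds_zero {β : ℝ} (hβ : β < 0) :
    Tendsto (fun N : ℕ => (N : ℝ) ^ β) atTop (nhds 0) := by
  rw [← neg_neg β]
  exact (tendsto_rpow_neg_atTop (neg_pos.2 hβ)).comp tendsto_natCast_atTop_atTop

theorem SpectralNonlinearity.hasNormInflation_of_isResonant [Finite ι] {σ : ℕ} {μ : ℝ}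
    {F : (EuclideanSpace ℝ (Fin d) → ℂ) → EuclideanSpace ℝ (Fin d) → ℂ}
    (S : SpectralNonlinearity d σ μ F) (hF : IsMeanLipschitz F) (hμ : μ ≠ 0)
    (hκ : ∀ i, κ i ≠ 0) (hres : IsResonant κ σ) {s : ℝ} (hs : s < 0) :
    HasNormInflation F s := by
  cases nonempty_fintype ι
  refine S.hasNormInflation_of_packets hF hμ hκ hs.le fun ε hε => ?_
  obtain ⟨A, hA, hAε⟩ : ∃ A : ℝ, 1 ≤ A ∧ 1 / ε ≤ ε * A := by
    refine ⟨max 1 (1 / ε / ε), le_max_left _ _, ?_⟩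
    exact (div_le_iff₀' hε).1 (le_max_right _ _)
  have hA0 : 0 < A := one_pos.trans_le hA
  have hT : 0 < ε / A ^ (2 * σ) := by positivity
  have hθ : ε / A ^ (2 * σ) * A ^ (2 * σ) = ε := div_mul_cancel₀ _ (by positivity)
  have hdata : ∀ᶠ N : ℕ in atTop, A * (N : ℝ) ^ s < ε :=
    ((tendsto_natCast_rpow_nhds_zero hs).const_mul A).eventually_lt_const (by simpa using hε)
  have hlong : Tendsto (fun N : ℕ => (N : ℝ) ^ 2 * (ε / A ^ (2 * σ))) atTop atTop :=
    ((tendsto_pow_atTop two_ne_zero).comp tendsto_natCast_atTop_atTop).atTop_mul_const hT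
  obtain ⟨N, hNs, hsource, hN⟩ := (hdata.and
    ((hlong.eventually hres.eventually_le_norm_integral_zeroModeSource).and
      (eventually_ne_atTop 0))).exists
  refine ⟨A, N, ε / A ^ (2 * σ), hA0.le, hN, hT, div_le_self hε.le (one_le_pow₀ hA), hθ.le,
    hNs.le, ?_, hsource⟩
  rwa [pow_succ, ← mul_assoc, hθ]

theorem SpectralNonlinearity.hasNormInflation_of_two_le {σ : ℕ} {μ : ℝ}
    {F : (EuclideanSpace ℝ (Fin d) → ℂ) → EuclideanSpace ℝ (Fin d) → ℂ}
    (S : SpectralNonlinearity d σ μ F) (hF : IsMeanLipschitz F) (hμ : μ ≠ 0) (h : 2 ≤ d * σ)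
    {s : ℝ} (hs : s < 0) : HasNormInflation F s :=
  let ⟨_, hκ, hres⟩ := exists_isResonant h
  S.hasNormInflation_of_isResonant hF hμ hκ hres hs

end Resonance

/-! ### The cubic equation on the circle -/

section Circle

open Filter

theorem zeroModeSource_one_two (t : ℝ) :
    zeroModeSource ![(1 : Fin 1 → ℤ), 2] 1 t = Complex.exp (t * Complex.I) := by
  have h2 : (2 : Fin 1 → ℤ) ≠ 0 := fun h => by simpa using congrFun h 0
  have h3 : (3 : Fin 1 → ℤ) ≠ 0 := fun h => by simpa using congrFun h 0
  rw [zeroModeSource]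
  change ∑ p : Fin 2 × Fin 2 × Fin 2, _ = _
  simp only [Fintype.sum_prod_type, Fin.sum_univ_two, alternatingSum]
  norm_num [dispersion, osc, h2, h3]
  rw [mul_comm]

theorem half_le_norm_integral_zeroModeSource_one_two :
    1 / 2 ≤ ‖∫ t in (0 : ℝ)..1, zeroModeSource ![(1 : Fin 1 → ℤ), 2] 1 t‖ := by
  have hint : ∫ t in (0 : ℝ)..1, zeroModeSource ![(1 : Fin 1 → ℤ), 2] 1 t =
      (Complex.exp ((1 : ℝ) * Complex.I) - 1) / Complex.I := by
    simp only [zeroModeSource_one_two, mul_comm _ Complex.I]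
    rw [integral_exp_mul_complex Complex.I_ne_zero]
    simp
  rw [hint, norm_div, Complex.norm_I, div_one]
  refine le_trans ?_ (Complex.abs_im_le_norm _)
  rw [Complex.sub_im, Complex.exp_ofReal_mul_I_im, Complex.one_im, sub_zero]
  refine le_trans ?_ (le_abs_self _)
  linarith [Real.sin_gt_sub_cube one_pos]

theorem SpectralNonlinearity.hasNormInflation_circle {μ : ℝ}
    {F : (EuclideanSpace ℝ (Fin 1) → ℂ) → EuclideanSpace ℝ (Fin 1) → ℂ}
    (S : SpectralNonlinearity 1 1 μ F) (hF : IsMeanLipschitz F) (hμ : μ ≠ 0) {s : ℝ}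
    (hs : s < -2 / 3) : HasNormInflation F s := by
  have hκ : ∀ i, ![(1 : Fin 1 → ℤ), 2] i ≠ 0 := fun i => by
    fin_cases i <;> exact fun h => by simpa using congrFun h 0
  refine S.hasNormInflation_of_packets hF hμ hκ (by linarith) fun ε hε => ?_
  obtain ⟨α, hα, hα'⟩ : ∃ α : ℝ, 2 / 3 < α ∧ α < min 1 (-s) :=
    exists_between (lt_min (by norm_num) (by linarith))
  obtain ⟨hα1, hαs⟩ := lt_min_iff.1 hα'
  have hsmall : ∀ {β : ℝ}, β < 0 → ∀ᶠ N : ℕ in atTop, (N : ℝ) ^ β < ε := fun hβ =>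
    (tendsto_natCast_rpow_nhds_zero hβ).eventually_lt_const hε
  have hlarge : ∀ᶠ N : ℕ in atTop, 1 / ε ≤ (N : ℝ) ^ (-2 + α * 3) :=
    ((tendsto_rpow_atTop (by linarith)).comp tendsto_natCast_atTop_atTop).eventually_ge_atTop _
  obtain ⟨N, hT, hθ, hdata, hout, hN⟩ := ((hsmall (β := -2) (by norm_num)).and
    ((hsmall (β := -2 + α * 2) (by linarith)).and ((hsmall (β := α + s) (by linarith)).and
      (hlarge.and (eventually_ne_atTop 0))))).exists
  have hN0 : (0 : ℝ) < N := by positivity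
  have hpow : ∀ n : ℕ, (N : ℝ) ^ (-2 : ℝ) * ((N : ℝ) ^ α) ^ n = (N : ℝ) ^ (-2 + α * n) :=
    fun n => by rw [Real.rpow_add hN0, Real.rpow_mul hN0.le, Real.rpow_natCast]
  have hunit : (N : ℝ) ^ 2 * (N : ℝ) ^ (-2 : ℝ) = 1 := by
    rw [Real.rpow_neg hN0.le, Real.rpow_two, mul_inv_cancel₀ (by positivity)]
  refine ⟨(N : ℝ) ^ α, N, (N : ℝ) ^ (-2 : ℝ), by positivity, hN, by positivity, hT.le, ?_, ?_, ?_,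
    ?_⟩
  · rw [hpow]
    exact_mod_cast hθ.le
  · rw [← Real.rpow_add hN0]
    exact hdata.le
  · rw [hpow]
    exact_mod_cast hout
  · rw [hunit]
    exact half_le_norm_integral_zeroModeSource_one_two

end Circle

end PeriodicNLS

end

theorem theorem1p1_general (σ d : ℕ) {μ : ℝ} (hμ : μ ≠ 0) :
    (2 ≤ d * σ → ∀ s : ℝ, s < 0 →
      PeriodicNLS.HasNormInflation (PeriodicNLS.powerNonlinearity d μ σ) s) ∧
    (2 ≤ d → ∀ s : ℝ, s < 0 →
      PeriodicNLS.HasNormInflation (PeriodicNLS.renormalizedNonlinearity d μ) s) ∧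
    (d = 1 → σ = 1 → ∀ s : ℝ, s < -2 / 3 →
      PeriodicNLS.HasNormInflation (PeriodicNLS.powerNonlinearity d μ σ) s ∧
      PeriodicNLS.HasNormInflation (PeriodicNLS.renormalizedNonlinearity d μ) s) := by
  refine ⟨fun h s hs => ?_, fun h s hs => ?_, ?_⟩
  · exact (PeriodicNLS.spectralPower d σ μ).hasNormInflation_of_two_le
      (PeriodicNLS.isMeanLipschitz_powerNonlinearity μ σ) hμ h hs
  · exact (PeriodicNLS.spectralRenormalized d μ).hasNormInflation_of_two_le
      (PeriodicNLS.isMeanLipschitz_renormalizedNonlinearity μ) hμ (by rwa [mul_one]) hs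
  · rintro rfl rfl s hs
    exact ⟨(PeriodicNLS.spectralPower 1 1 μ).hasNormInflation_circle
        (PeriodicNLS.isMeanLipschitz_powerNonlinearity μ 1) hμ hs,
      (PeriodicNLS.spectralRenormalized 1 μ).hasNormInflation_circle
        (PeriodicNLS.isMeanLipschitz_renormalizedNonlinearity μ) hμ hs⟩

theorem theorem1p1 (σ d : ℕ) (hσ : 1 ≤ σ) (hd : 1 ≤ d) (μ : ℝ) (hμ : μ = 1 ∨ μ = -1) :
    (2 ≤ d * σ → ∀ s : ℝ, s < 0 →
      PeriodicNLS.HasNormInflation (PeriodicNLS.powerNonlinearity d μ σ) s) ∧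
    (2 ≤ d → ∀ s : ℝ, s < 0 →
      PeriodicNLS.HasNormInflation (PeriodicNLS.renormalizedNonlinearity d μ) s) ∧
    (d = 1 → σ = 1 → ∀ s : ℝ, s < -2 / 3 →
      PeriodicNLS.HasNormInflation (PeriodicNLS.powerNonlinearity d μ σ) s ∧
      PeriodicNLS.HasNormInflation (PeriodicNLS.renormalizedNonlinearity d μ) s) :=
  theorem1p1_general σ d (by rcases hμ with rfl | rfl <;> norm_num)
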